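/- Let $V$ be a finite-dimensional real vector space, $n=\dim_{\mathbb R}V$, let $N\subseteq V$ be a $\mathbb Z$-structure on $V$ (a free subgroup of rank $n$ that spans $V$ over $\mathbb R$), and let $M=\{u\in V^*\mid u(N)\subseteq\mathbb Z\}$ be the dual $\mathbb Z$-structure on $V^*$. An $N$-polycone is a cone in $V$ generated by a finite subset of $N$ and containing no line; for such a $\sigma$ let $\sigma^\vee_M=\{u\in M\mid u(\sigma)\subseteq\mathbb R_{\ge 0}\}$. A face of $\sigma$ is a set $\sigma\cap\ker u$ with $u\in\sigma^\vee_M$. An $N$-fan is a finite (possibly empty) set $\Sigma$ of $N$-polycones that contains every face of each of its members and such that $\sigma\cap\tau$ is a face of $\sigma$ for all $\sigma,\tau\in\Sigma$. It is called $N$-regular if every $\sigma\in\Sigma$ is generated (as a cone) by a subset of a $\mathbb Z$-basis of $N$. For an $N$-fan $\Sigma$, let $X_\Sigma(\mathbb Z)$ be the inductive limit of the schemes $\operatorname{Spec}\mathbb Z[\sigma^\vee_M]$ over $\sigma\in\Sigma$ (ordered by inclusion), with the open immersions $\operatorname{Spec}\mathbb Z[\tau^\vee_M]\to\operatorname{Spec}\mathbb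 Z[\sigma^\vee_M]$ for $\tau\subseteq\sigma$ induced by $\sigma^\vee_M\subseteq\tau^\vee_M$. For a scheme $S$ let $X_\Sigma(S)=X_\Sigma(\mathbb Z)\times S$, with projection $t_\Sigma(S)\colon X_\Sigma(S)\to S$. For $k\in\mathbb N$, a scheme $X$ has $(R_k)$ if it is locally noetherian and $\mathcal O_{X,x}$ is a regular local ring for every $x\in X$ with $\dim\mathcal O_{X,x}\le k$. A morphism of schemes $X\to Y$ has $(R_k)$ if it is flat and $X_z\otimes_{\kappa(z)}K$ has $(R_k)$ for every $z\in Y$ and every finite field extension $K$ of $\kappa(z)$, where $X_z$ denotes the fibre over $z$. A morphism is regular if it has $(R_k)$ for every $k\in\mathbb N$. Theorem. For every $N$-fan $\Sigma$ in $V$ and every scheme $S$, the following are equivalent: (i) $t_\Sigma(S)$ is regular; (ii) $t_\Sigma(S)$ has $(R_n)$; (iii) $\Sigma$ is $N$-regular or $S=\emptyset$. -/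

import Mathlib

open CategoryTheory CategoryTheory.Limits AlgebraicGeometry

universe u

noncomputable section

namespace ToricScheme

/-! ### Lattices, polycones and fans -/

section Fans

variable {V : Type u} [AddCommGroup V] [Module ℝ V]

/-- `N` is a `ℤ`-structure on `V`: a free subgroup of rank `dim V` that spans `V` over `ℝ`. -/
structure IsZStructure (N : AddSubgroup V) : Prop where
  free : Module.Free ℤ N
  finrank_eq : Module.finrank ℤ N = Module.finrank ℝ V
  span_eq_top : Submodule.span ℝ (N : Set V) = ⊤

/-- The dual `ℤ`-structure `M = N^*`: the linear forms on `V` that are integral on `N`. -/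
def dualLattice (N : AddSubgroup V) : AddSubgroup (Module.Dual ℝ V) where
  carrier := {u | ∀ x ∈ N, ∃ k : ℤ, u x = k}
  zero_mem' := fun _ _ => ⟨0, by simp⟩
  add_mem' := by
    intro u v hu hv x hx
    obtain ⟨k, hk⟩ := hu x hx
    obtain ⟨l, hl⟩ := hv x hx
    exact ⟨k + l, by simp [hk, hl]⟩
  neg_mem' := by
    intro u hu x hx
    obtain ⟨k, hk⟩ := hu x hx
    exact ⟨-k, by simp [hk]⟩

/-- The monoid `σ^∨ ∩ M` of integral linear forms that are nonnegative on `σ`. -/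
def dualMonoid (N : AddSubgroup V) (σ : PointedCone ℝ V) : AddSubmonoid (Module.Dual ℝ V) where
  carrier := {u | u ∈ dualLattice N ∧ ∀ x ∈ σ, 0 ≤ u x}
  zero_mem' := ⟨zero_mem _, by simp⟩
  add_mem' := by
    intro u v hu hv
    exact ⟨add_mem hu.1 hv.1, fun x hx => add_nonneg (hu.2 x hx) (hv.2 x hx)⟩

/-- An `N`-polycone: a cone generated by a finite subset of `N` that contains no line. -/
structure IsPolycone (N : AddSubgroup V) (σ : PointedCone ℝ V) : Prop where
  exists_generators : ∃ A : Finset V, (A : Set V) ⊆ N ∧ σ = PointedCone.hull ℝ (A : Set V)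
  salient : ∀ x ∈ σ, -x ∈ σ → x = 0

/-- `τ` is a face of `σ`: it is `σ ∩ ker u` for some `u ∈ σ^∨ ∩ M`. -/
def IsFace (N : AddSubgroup V) (τ σ : PointedCone ℝ V) : Prop :=
  ∃ u ∈ dualMonoid N σ, ∀ x, x ∈ τ ↔ x ∈ σ ∧ u x = 0

end Fans

/-- An `N`-fan in `V` (possibly empty). -/
structure NFan {V : Type u} [AddCommGroup V] [Module ℝ V] (N : AddSubgroup V) where
  cones : Set (PointedCone ℝ V)
  finite : cones.Finite
  isPolycone : ∀ σ ∈ cones, IsPolycone N σ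
  face_mem : ∀ σ ∈ cones, ∀ τ, IsFace N τ σ → τ ∈ cones
  inf_isFace : ∀ σ ∈ cones, ∀ τ ∈ cones, IsFace N (σ ⊓ τ) σ

section Gluing

variable {V : Type u} [AddCommGroup V] [Module ℝ V] {N : AddSubgroup V}

/-- `Σ` is `N`-regular: every `σ ∈ Σ` is generated by a subset of a `ℤ`-basis of `N`. -/
def NFan.IsRegular (F : NFan N) : Prop :=
  ∀ σ ∈ F.cones, ∃ (b : Module.Basis (Fin (Module.finrank ℝ V)) ℤ N)
    (s : Set (Fin (Module.finrank ℝ V))),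
    σ = PointedCone.hull ℝ ((fun i => (b i : V)) '' s)

/-- The fan as an ordered set, ordered by inclusion. -/
abbrev NFan.Index (F : NFan N) : Type u := {σ : PointedCone ℝ V // σ ∈ F.cones}

lemma dualMonoid_anti {τ σ : PointedCone ℝ V} (h : τ ≤ σ) : dualMonoid N σ ≤ dualMonoid N τ :=
  fun _ hu => ⟨hu.1, fun x hx => hu.2 x (h hx)⟩

/-- The morphism `ℤ[σ^∨ ∩ M] → ℤ[τ^∨ ∩ M]` induced by `τ ⊆ σ`. -/
def restrictionHom (N : AddSubgroup V) {τ σ : PointedCone ℝ V} (h : τ ≤ σ) :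
    AddMonoidAlgebra ℤ (dualMonoid N σ) →+* AddMonoidAlgebra ℤ (dualMonoid N τ) :=
  AddMonoidAlgebra.mapDomainRingHom ℤ (AddSubmonoid.inclusion (dualMonoid_anti h))

/-- The inductive system `σ ↦ X_σ(ℤ) = Spec ℤ[σ^∨ ∩ M]` over the ordered set `Σ`. -/
def NFan.diagram (F : NFan N) : F.Index ⥤ Scheme.{u} where
  obj σ := Spec (CommRingCat.of (AddMonoidAlgebra ℤ (dualMonoid N σ.1)))
  map f := Spec.map (CommRingCat.ofHom (restrictionHom N (leOfHom f)))
  map_id σ := by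
    rw [← Spec.map_id]
    congr 1
    ext1
    exact AddMonoidAlgebra.mapDomainRingHom_id
  map_comp {a b c} f g := by
    rw [← Spec.map_comp]
    congr 1
    ext1
    exact AddMonoidAlgebra.mapDomainRingHom_comp (R := ℤ)
      (AddSubmonoid.inclusion (dualMonoid_anti (N := N) (leOfHom f)))
      (AddSubmonoid.inclusion (dualMonoid_anti (N := N) (leOfHom g)))

lemma exists_nsmul_add_mem {τ σ : PointedCone ℝ V} (hσ : IsPolycone N σ)
    {u : Module.Dual ℝ V} (hu : u ∈ dualMonoid N σ) (hτ : ∀ x, x ∈ τ ↔ x ∈ σ ∧ u x = 0)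
    {m : Module.Dual ℝ V} (hm : m ∈ dualMonoid N τ) :
    ∃ k₀ : ℕ, ∀ k ≥ k₀, m + k • u ∈ dualMonoid N σ := by
  obtain ⟨A, -, rfl⟩ := hσ.exists_generators
  have key : ∀ a ∈ A, ∃ k₀ : ℕ, ∀ k ≥ k₀, 0 ≤ (m + k • u) a := by
    intro a ha
    have haσ : a ∈ PointedCone.hull ℝ (A : Set V) := PointedCone.subset_hull ha
    rcases (hu.2 a haσ).eq_or_lt with h0 | h0
    · refine ⟨0, fun k _ => ?_⟩
      have := hm.2 a ((hτ a).2 ⟨haσ, h0.symm⟩)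
      simpa [← h0] using this
    · obtain ⟨k₀, hk₀⟩ := exists_nat_ge (-(m a) / u a)
      refine ⟨k₀, fun k hk => ?_⟩
      have h1 : -(m a) / u a ≤ k := hk₀.trans (by exact_mod_cast hk)
      rw [div_le_iff₀ h0] at h1
      simp
      linarith
  choose! f hf using key
  refine ⟨A.sup f, fun k hk => ⟨add_mem hm.1 (nsmul_mem hu.1 k), fun x hx => ?_⟩⟩
  induction hx using Submodule.span_induction with
  | mem a ha => exact hf a ha k ((Finset.le_sup (f := f) ha).trans hk)
  | zero => simp
  | add x y _ _ hx hy => rw [map_add]; exact add_nonneg hx hy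
  | smul c x _ hx =>
    change 0 ≤ (m + k • u) ((c : ℝ) • x)
    rw [map_smul]
    exact mul_nonneg c.2 hx

lemma restrictionHom_injective {τ σ : PointedCone ℝ V} (h : τ ≤ σ) :
    Function.Injective (restrictionHom N h) :=
  AddMonoidAlgebra.mapDomain_injective (AddSubmonoid.inclusion_injective _)

lemma restrictionHom_single {τ σ : PointedCone ℝ V} (h : τ ≤ σ) (m : dualMonoid N σ) (r : ℤ) :
    restrictionHom N h (AddMonoidAlgebra.single m r) =
      AddMonoidAlgebra.single (AddSubmonoid.inclusion (dualMonoid_anti h) m) r :=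
  AddMonoidAlgebra.mapDomain_single

/-- If `τ = σ ∩ ker u` then `ℤ[τ^∨ ∩ M]` is the localization of `ℤ[σ^∨ ∩ M]` at `e_u`. -/
lemma isLocalization_restrictionHom {τ σ : PointedCone ℝ V} (h : τ ≤ σ) (hσ : IsPolycone N σ)
    (u : dualMonoid N σ) (hτ : ∀ x, x ∈ τ ↔ x ∈ σ ∧ u.1 x = 0) :
    letI := (restrictionHom N h).toAlgebra
    IsLocalization.Away (AddMonoidAlgebra.single u (1 : ℤ))
      (AddMonoidAlgebra ℤ (dualMonoid N τ)) := by
  let := (restrictionHom N h).toAlgebra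
  have halg : algebraMap (AddMonoidAlgebra ℤ (dualMonoid N σ))
    (AddMonoidAlgebra ℤ (dualMonoid N τ)) = restrictionHom N h := rfl
  have hneg : -u.1 ∈ dualMonoid N τ :=
    ⟨neg_mem u.2.1, fun x hx => by simp [((hτ x).1 hx).2]⟩
  refine IsLocalization.Away.mk _ ?_ ?_ ?_
  · rw [halg, restrictionHom_single]
    refine IsUnit.of_mul_eq_one (AddMonoidAlgebra.single (⟨-u.1, hneg⟩ : dualMonoid N τ) 1) ?_
    rw [AddMonoidAlgebra.single_mul_single, AddMonoidAlgebra.one_def, mul_one]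
    congr 1
    ext1
    simp
  · have main : ∀ z : AddMonoidAlgebra ℤ (dualMonoid N τ), ∃ k₀ : ℕ, ∀ k ≥ k₀,
        ∃ a, z * (restrictionHom N h (AddMonoidAlgebra.single u 1)) ^ k =
          restrictionHom N h a := by
      intro z
      induction z using AddMonoidAlgebra.induction_linear with
      | zero => exact ⟨0, fun k _ => ⟨0, by simp⟩⟩
      | add z w hz hw =>
        obtain ⟨k, hk⟩ := hz
        obtain ⟨l, hl⟩ := hw
        refine ⟨max k l, fun j hj => ?_⟩
        obtain ⟨a, ha⟩ := hk j (le_trans (le_max_left _ _) hj)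
        obtain ⟨b, hb⟩ := hl j (le_trans (le_max_right _ _) hj)
        exact ⟨a + b, by rw [add_mul, ha, hb, map_add]⟩
      | single m r =>
        obtain ⟨k₀, hk₀⟩ := exists_nsmul_add_mem hσ u.2 hτ m.2
        refine ⟨k₀, fun k hk => ⟨AddMonoidAlgebra.single ⟨_, hk₀ k hk⟩ r, ?_⟩⟩
        rw [restrictionHom_single, restrictionHom_single, AddMonoidAlgebra.single_pow,
          AddMonoidAlgebra.single_mul_single, one_pow, mul_one]
        congr 1
    intro z
    obtain ⟨k, hk⟩ := main z
    obtain ⟨a, ha⟩ := hk k le_rfl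
    exact ⟨k, a, ha⟩
  · intro a b hab
    exact ⟨0, by rw [restrictionHom_injective h hab]⟩

lemma isOpenImmersion_restrictionHom {τ σ : PointedCone ℝ V} (h : τ ≤ σ) (hσ : IsPolycone N σ)
    (u : dualMonoid N σ) (hτ : ∀ x, x ∈ τ ↔ x ∈ σ ∧ u.1 x = 0) :
    IsOpenImmersion (Spec.map (CommRingCat.ofHom (restrictionHom N h))) := by
  let := (restrictionHom N h).toAlgebra
  have := isLocalization_restrictionHom h hσ u hτ
  exact IsOpenImmersion.of_isLocalization (AddMonoidAlgebra.single u (1 : ℤ))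

lemma range_restrictionHom {τ σ : PointedCone ℝ V} (h : τ ≤ σ) (hσ : IsPolycone N σ)
    (u : dualMonoid N σ) (hτ : ∀ x, x ∈ τ ↔ x ∈ σ ∧ u.1 x = 0) :
    Set.range (PrimeSpectrum.comap (restrictionHom N h)) =
      PrimeSpectrum.basicOpen (AddMonoidAlgebra.single u (1 : ℤ)) := by
  let := (restrictionHom N h).toAlgebra
  have := isLocalization_restrictionHom h hσ u hτ
  exact PrimeSpectrum.localization_away_comap_range _ (AddMonoidAlgebra.single u (1 : ℤ))

lemma NFan.isFace_of_le (F : NFan N) {τ σ : F.Index} (h : τ ≤ σ) : IsFace N τ.1 σ.1 := by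
  have := F.inf_isFace σ.1 σ.2 τ.1 τ.2
  rwa [inf_eq_right.2 h] at this

instance NFan.isOpenImmersion_map (F : NFan N) {τ σ : F.Index} (f : τ ⟶ σ) :
    IsOpenImmersion (F.diagram.map f) := by
  obtain ⟨u, hu, hτ⟩ := F.isFace_of_le (leOfHom f)
  exact isOpenImmersion_restrictionHom (leOfHom f) (F.isPolycone σ.1 σ.2) ⟨u, hu⟩ hτ

instance NFan.isLocallyDirected (F : NFan N) :
    (F.diagram ⋙ Scheme.forget).IsLocallyDirected where
  cond {i j k} fi fj xi xj heq := by
    obtain ⟨u, hu, hi⟩ := F.isFace_of_le (leOfHom fi)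
    obtain ⟨v, hv, hj⟩ := F.isFace_of_le (leOfHom fj)
    let l : F.Index := ⟨i.1 ⊓ j.1, F.face_mem i.1 i.2 _ (F.inf_isFace i.1 i.2 j.1 j.2)⟩
    let fli : l ⟶ i := homOfLE (inf_le_left : i.1 ⊓ j.1 ≤ i.1)
    let flj : l ⟶ j := homOfLE (inf_le_right : i.1 ⊓ j.1 ≤ j.1)
    have hl : ∀ x, x ∈ l.1 ↔ x ∈ k.1 ∧ (u + v) x = 0 := by
      intro x
      change x ∈ i.1 ∧ x ∈ j.1 ↔ _
      rw [hi, hj, LinearMap.add_apply]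
      constructor
      · rintro ⟨⟨h1, h2⟩, -, h3⟩
        exact ⟨h1, by rw [h2, h3, add_zero]⟩
      · rintro ⟨h1, h2⟩
        have h3 := hu.2 x h1
        have h4 := hv.2 x h1
        exact ⟨⟨h1, by linarith⟩, h1, by linarith⟩
    have hk := F.isPolycone k.1 k.2
    have ri := range_restrictionHom (leOfHom fi) hk ⟨u, hu⟩ hi
    have rj := range_restrictionHom (leOfHom fj) hk ⟨v, hv⟩ hj
    have rl := range_restrictionHom (leOfHom (fli ≫ fi)) hk ⟨u + v, add_mem hu hv⟩ hl
    replace heq : F.diagram.map fi xi = F.diagram.map fj xj := heq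
    have hmem : F.diagram.map fi xi ∈ Set.range (F.diagram.map (fli ≫ fi)) := by
      have e1 : F.diagram.map fi xi ∈
          PrimeSpectrum.basicOpen (AddMonoidAlgebra.single (⟨u, hu⟩ : dualMonoid N k.1) (1 : ℤ)) :=
        ri.subset ⟨xi, rfl⟩
      have e2 : F.diagram.map fi xi ∈
          PrimeSpectrum.basicOpen (AddMonoidAlgebra.single (⟨v, hv⟩ : dualMonoid N k.1) (1 : ℤ)) :=
        heq ▸ rj.subset ⟨xj, rfl⟩
      have e3 : F.diagram.map fi xi ∈ PrimeSpectrum.basicOpen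
          (AddMonoidAlgebra.single (⟨u + v, add_mem hu hv⟩ : dualMonoid N k.1) (1 : ℤ)) := by
        have : (AddMonoidAlgebra.single (⟨u + v, add_mem hu hv⟩ : dualMonoid N k.1) (1 : ℤ)) =
            AddMonoidAlgebra.single (⟨u, hu⟩ : dualMonoid N k.1) (1 : ℤ) *
              AddMonoidAlgebra.single (⟨v, hv⟩ : dualMonoid N k.1) (1 : ℤ) := by
          rw [AddMonoidAlgebra.single_mul_single, mul_one]
          rfl
        rw [this, PrimeSpectrum.basicOpen_mul]
        exact ⟨e1, e2⟩
      exact rl.superset e3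
    obtain ⟨x, hx⟩ := hmem
    refine ⟨l, fli, flj, x, ?_, ?_⟩
    · change F.diagram.map fli x = xi
      apply (F.diagram.map fi).injective
      rw [← hx, F.diagram.map_comp, Scheme.Hom.comp_apply]
    · change F.diagram.map flj x = xj
      apply (F.diagram.map fj).injective
      rw [← heq, ← hx, ← Scheme.Hom.comp_apply, ← F.diagram.map_comp]
      rfl

/-- `X_Σ(ℤ)`: the inductive limit of the `X_σ(ℤ)`, that is, the scheme obtained by gluing them
along the `X_{σ ∩ τ}(ℤ)`. -/
def NFan.toricSchemeInt (F : NFan N) : Scheme.{u} := colimit F.diagram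

/-- `X_Σ(S) = X_Σ(ℤ) × S`. -/
def NFan.toricScheme (F : NFan N) (S : Scheme.{u}) : Scheme.{u} :=
  pullback (terminal.from F.toricSchemeInt) (terminal.from S)

/-- The structural morphism `t_Σ(S) : X_Σ(S) → S`. -/
def NFan.toricMorphism (F : NFan N) (S : Scheme.{u}) : F.toricScheme S ⟶ S :=
  pullback.snd (terminal.from F.toricSchemeInt) (terminal.from S)

end Gluing

/-! ### Serre's properties `(R_k)` and regularity -/

/-- A scheme has `(R_k)`: it is locally noetherian and its local rings of dimension at most `k`
are regular. -/
def HasR (k : ℕ) (X : Scheme.{u}) : Prop :=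
  IsLocallyNoetherian X ∧ ∀ x : X,
    ringKrullDim (X.presheaf.stalk x) ≤ k → IsRegularLocalRing (X.presheaf.stalk x)

/-- A morphism has `(R_k)`: it is flat, and for every point `z` of the target and every finite
field extension `K` of `κ(z)` the base change to `K` of the fibre over `z` has `(R_k)`. -/
def HomHasR (k : ℕ) {X Y : Scheme.{u}} (f : X ⟶ Y) : Prop :=
  Flat f ∧ ∀ (z : Y) (K : Type u) [Field K] [Algebra (Y.residueField z) K]
    [FiniteDimensional (Y.residueField z) K],
    HasR k (pullback (f.fiberToSpecResidueField z)
      (Spec.map (CommRingCat.ofHom (algebraMap (Y.residueField z) K))))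

/-- A morphism is regular if it has `(R_k)` for every `k`. -/
def HomIsRegular {X Y : Scheme.{u}} (f : X ⟶ Y) : Prop := ∀ k : ℕ, HomHasR k f

end ToricScheme

end

/-! Base change of the fibre of `t_Σ(S)` at `z` to `K` is `X_Σ(ℤ) × Spec K`, whatever `S` is. It is
covered by open pieces `Spec K[P]` with `P = σ^∨ ∩ M`, and `(R_k)` is local for open covers.
Flatness is automatic, since `ℤ[P]` is free over `ℤ`. So everything reduces to regularity of `K[P]`
over a field.

If `σ` is spanned by part of a basis of `N`, it is a face of the cone `τ` on the whole basis. The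
algebra of `τ` is a polynomial ring, so `Spec K[P]` is open in an affine space, hence regular
(`hasR_of_isRegular`).

Conversely, send `e_p` to `1` if `p` is a unit of `P` and to `0` otherwise. The kernel is a
distinguished prime, whose local ring has dimension at most `dim K[P] ≤ n`, so `(R_n)` makes it
regular and its maximal ideal has at most `n` generators. Irreducible elements modulo units,
together with a basis of the unit group, yield independent tangent vectors there
(`card_le_of_isRegularLocalRing`), so there are at most `n` of them. Since they also generate `M`,
they form a basis of `M`, and `P` consists of the elements whose coordinates along the irreducibles
are nonnegative (`exists_basis_of_isRegularLocalRing`). A polycone is determined by its dual monoid,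
so `σ` is spanned by part of the dual basis. -/

noncomputable section

namespace ToricScheme

/-! ### Krull dimension and transcendence degree -/

section Dimension

open Cardinal

variable (K : Type*) [Field K]

/-- Passing to the quotient by a nonzero ideal drops the transcendence degree. -/
lemma trdeg_quotient_lt {A : Type u} [CommRing A] [IsDomain A] [Algebra K A]
    (hfin : Algebra.trdeg K A < ℵ₀) (q : Ideal A) [q.IsPrime] (hq : q ≠ ⊥) :
    Algebra.trdeg K (A ⧸ q) < Algebra.trdeg K A := by
  by_contra hle
  rw [not_lt] at hle
  have : FaithfulSMul K (A ⧸ q) :=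
    (faithfulSMul_iff_algebraMap_injective K (A ⧸ q)).2 (algebraMap K (A ⧸ q)).injective
  obtain ⟨s, hs⟩ := exists_isTranscendenceBasis K (A ⧸ q)
  let y : s → A := fun i => (Ideal.Quotient.mk_surjective i.1).choose
  have hy : ∀ i, Ideal.Quotient.mkₐ K q (y i) = i.1 := fun i =>
    (Ideal.Quotient.mk_surjective i.1).choose_spec
  have hcomp : Ideal.Quotient.mkₐ K q ∘ y = Subtype.val := funext hy
  have hyi : AlgebraicIndependent K y := by
    refine AlgebraicIndependent.of_ringHom_of_comp_eq (RingHom.id K) (Ideal.Quotient.mkₐ K q) ?_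
      Function.injective_id ?_
    · rw [hcomp]; exact hs.1
    · ext; rfl
  -- The lifts are independent and, by the contrary assumption, at least `trdeg A` many. Finiteness
  -- of the degree makes them a transcendence basis.
  have hyb : IsTranscendenceBasis K y := by
    refine hyi.isTranscendenceBasis_of_trdeg_le hfin ?_
    rw [hs.cardinalMk_eq_trdeg]
    exact hle
  have := hyb.isAlgebraic
  obtain ⟨a, haq, ha0⟩ := q.ne_bot_iff.1 hq
  -- A nonzero algebraic element of `q` forces `q` to contain a nonzero polynomial in the lifts.
  -- Modulo `q` this is a relation between the elements of `s`.
  have hne := Ideal.comap_ne_bot_of_algebraic_mem ha0 haq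
    (Algebra.IsAlgebraic.isAlgebraic (R := Algebra.adjoin K (Set.range y)) a)
  obtain ⟨⟨c, hc⟩, hcq, hc0⟩ := (Submodule.ne_bot_iff _).1 hne
  rw [Algebra.adjoin_range_eq_range_aeval] at hc
  obtain ⟨p, rfl⟩ := hc
  replace hcq : MvPolynomial.aeval y p ∈ q := hcq
  have h0 : Ideal.Quotient.mkₐ K q (MvPolynomial.aeval y p) = 0 :=
    Ideal.Quotient.eq_zero_iff_mem.2 hcq
  rw [← AlgHom.comp_apply, MvPolynomial.comp_aeval] at h0
  have hp : p = 0 := by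
    apply hs.1
    rw [map_zero, ← h0]
    congr 2
    exact funext fun i => (hy i).symm
  exact hc0 (Subtype.ext (by simp [hp]))

/-- The Krull dimension of a domain over a field is at most its transcendence degree. -/
lemma ringKrullDim_le_of_trdeg_le {A : Type u} [CommRing A] [IsDomain A] [Algebra K A] (n : ℕ)
    (h : Algebra.trdeg K A ≤ n) : ringKrullDim A ≤ n := by
  have hle : ∀ p : PrimeSpectrum A, Algebra.trdeg K (A ⧸ p.asIdeal) ≤ n := fun p =>
    (trdeg_le_of_surjective (Ideal.Quotient.mkₐ K p.asIdeal)
      Ideal.Quotient.mk_surjective).trans h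
  have hlt : ∀ p : PrimeSpectrum A, Algebra.trdeg K (A ⧸ p.asIdeal) < ℵ₀ := fun p =>
    (hle p).trans_lt (natCast_lt_aleph0)
  -- The degree of `A ⧸ p` drops strictly as `p` grows and takes at most `n + 1` values, which
  -- bounds chains of primes.
  let f : PrimeSpectrum A → (Fin (n + 1))ᵒᵈ := fun p =>
    OrderDual.toDual ⟨toNat (Algebra.trdeg K (A ⧸ p.asIdeal)), by
      have := toNat_le_toNat (hle p) natCast_lt_aleph0
      rw [toNat_natCast] at this
      omega⟩
  have hf : StrictMono f := by
    intro p q hpq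
    change toNat (Algebra.trdeg K (A ⧸ q.asIdeal)) < toNat (Algebra.trdeg K (A ⧸ p.asIdeal))
    refine toNat_lt_toNat ?_ (hlt p)
    have hpq' : p.asIdeal < q.asIdeal := hpq
    let g : A ⧸ p.asIdeal →ₐ[K] A ⧸ q.asIdeal := Ideal.Quotient.factorₐ K hpq'.le
    have hg : Function.Surjective g := Ideal.Quotient.factor_surjective hpq'.le
    have : (RingHom.ker g).IsPrime := RingHom.ker_isPrime _
    have hne : RingHom.ker g ≠ ⊥ := by
      obtain ⟨a, haq, hap⟩ := SetLike.exists_of_lt hpq'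
      refine (Submodule.ne_bot_iff _).2 ⟨Ideal.Quotient.mk _ a, ?_, ?_⟩
      · exact Ideal.Quotient.eq_zero_iff_mem.2 haq
      · rwa [Ne, Ideal.Quotient.eq_zero_iff_mem]
    refine lt_of_le_of_lt ?_ (trdeg_quotient_lt K (hlt p) (RingHom.ker g) hne)
    exact trdeg_le_of_surjective
      (Ideal.quotientKerAlgEquivOfSurjective hg).toAlgHom
      (Ideal.quotientKerAlgEquivOfSurjective hg).surjective
  refine (Order.krullDim_le_of_strictMono f hf).trans ?_
  rw [Order.krullDim_orderDual]
  refine iSup_le fun p => ?_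
  have := p.length_lt_card
  rw [Fintype.card_fin] at this
  exact_mod_cast Nat.lt_succ_iff.1 this

end Dimension

/-! ### Dimension of monoid algebras -/

section MonoidAlgebraDimension

open Cardinal

variable (K : Type u) [Field K]

/-- Unique sums pass to submonoids and exclude zero divisors in monoid algebras. -/
lemma uniqueSums_of_free (G : Type*) [AddCommGroup G] [Module.Free ℤ G] : UniqueSums G :=
  UniqueSums.of_injective_addHom
    (Module.Free.chooseBasis ℤ G).repr.toAddEquiv.toAddMonoidHom.toAddHom
    (Module.Free.chooseBasis ℤ G).repr.injective inferInstance

lemma isDomain_addMonoidAlgebra {P G : Type*} [AddCommMonoid P] [AddCommGroup G]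
    [Module.Free ℤ G] (ι : P →+ G) (hι : Function.Injective ι) :
    IsDomain (AddMonoidAlgebra K P) := by
  have := uniqueSums_of_free G
  have : UniqueSums P := UniqueSums.of_injective_addHom ι.toAddHom hι inferInstance
  exact NoZeroDivisors.to_isDomain _

/-- The group algebra of a free abelian group has transcendence degree at most its rank. -/
lemma trdeg_addMonoidAlgebra_le (G : Type u) [AddCommGroup G] [Module.Free ℤ G]
    [Module.Finite ℤ G] : Algebra.trdeg K (AddMonoidAlgebra K G) ≤ Module.finrank ℤ G := by
  have : IsDomain (AddMonoidAlgebra K G) := isDomain_addMonoidAlgebra K (AddMonoidHom.id G)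
    Function.injective_id
  let b := Module.finBasis ℤ G
  let s := Set.range fun i => (AddMonoidAlgebra.single (b i) 1 : AddMonoidAlgebra K G)
  let A := Algebra.adjoin K s
  have hone : IsAlgebraic A (AddMonoidAlgebra.single (0 : G) (1 : K)) := isAlgebraic_one
  -- Exponents whose monomials are algebraic over `A` form a subgroup. It contains the basis, hence
  -- is all of `G`.
  let H : AddSubgroup G :=
    { carrier := {g | IsAlgebraic A (AddMonoidAlgebra.single g (1 : K))}
      zero_mem' := hone
      add_mem' := by
        intro g h hg hh
        have := IsAlgebraic.mul hg hh
        rwa [AddMonoidAlgebra.single_mul_single, mul_one] at this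
      neg_mem' := by
        intro g hg
        refine IsAlgebraic.of_mul (y := AddMonoidAlgebra.single g (1 : K)) ?_ hg ?_
        · refine mem_nonZeroDivisors_of_ne_zero fun h => ?_
          simp at h
        · rwa [AddMonoidAlgebra.single_mul_single, mul_one, add_neg_cancel] }
  have hH : (⊤ : Submodule ℤ G) ≤ AddSubgroup.toIntSubmodule H := by
    rw [← b.span_eq, Submodule.span_le]
    rintro _ ⟨i, rfl⟩
    exact isAlgebraic_algebraMap (⟨_, Algebra.subset_adjoin ⟨i, rfl⟩⟩ : A)
  have halg : Algebra.IsAlgebraic A (AddMonoidAlgebra K G) := by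
    refine ⟨fun x => ?_⟩
    induction x using AddMonoidAlgebra.induction_on with
    | of m => exact hH (Submodule.mem_top (x := m))
    | add x y hx hy => exact hx.add hy
    | smul r x hx =>
      rw [← algebraMap_smul A r x, Algebra.smul_def]
      exact (isAlgebraic_algebraMap _).mul hx
  refine (Algebra.IsAlgebraic.trdeg_le_cardinalMk K s).trans ?_
  have hle := mk_range_le_lift
    (f := fun i => (AddMonoidAlgebra.single (b i) 1 : AddMonoidAlgebra K G))
  simpa [s] using hle

lemma ringKrullDim_addMonoidAlgebra_le {P G : Type u} [AddCommMonoid P] [AddCommGroup G]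
    [Module.Free ℤ G] [Module.Finite ℤ G] (ι : P →+ G) (hι : Function.Injective ι) :
    ringKrullDim (AddMonoidAlgebra K P) ≤ Module.finrank ℤ G := by
  have := isDomain_addMonoidAlgebra K ι hι
  refine ringKrullDim_le_of_trdeg_le K _ ?_
  refine le_trans ?_ (trdeg_addMonoidAlgebra_le K G)
  exact trdeg_le_of_injective (AddMonoidAlgebra.mapDomainAlgHom K K ι)
    (AddMonoidAlgebra.mapDomain_injective hι)

end MonoidAlgebraDimension

/-! ### Tangent vectors and embedding dimension -/

section Tangent

variable {K : Type*} [Field K] {W : Type*} [AddCommGroup W] [Module K W]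
  [Module Kᵐᵒᵖ W] [IsCentralScalar K W]

/-- A `K`-algebra homomorphism to a square-zero extension `K ⊕ W` hitting `W` by elements of
the kernel of the composite to `K` bounds `dim W` by the embedding dimension at that kernel. -/
lemma finrank_le_spanFinrank_of_trivSqZeroExt {R : Type*} [CommRing R] [Algebra K R]
    (f : R →ₐ[K] TrivSqZeroExt K W) (m : Ideal R) [m.IsPrime]
    (hm : ∀ r, r ∈ m ↔ (f r).fst = 0)
    (hfg : (IsLocalRing.maximalIdeal (Localization.AtPrime m)).FG)
    (hW : Submodule.span K {w : W | ∃ r ∈ m, f r = TrivSqZeroExt.inr w} = ⊤) :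
    Module.finrank K W ≤ (IsLocalRing.maximalIdeal (Localization.AtPrime m)).spanFinrank := by
  -- Invertibility in a square-zero extension is tested on the first component, so `f` extends to
  -- the localization.
  have hunit : ∀ y : m.primeCompl, IsUnit (f.toRingHom y) := by
    intro y
    refine TrivSqZeroExt.isUnit_iff_isUnit_fst.2 (isUnit_iff_ne_zero.2 fun h => y.2 ((hm _).2 h))
  let g : Localization.AtPrime m →+* TrivSqZeroExt K W := IsLocalization.lift hunit
  have hg : ∀ r, g (algebraMap R _ r) = f r := fun r => IsLocalization.lift_eq hunit r
  let M := IsLocalRing.maximalIdeal (Localization.AtPrime m)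
  have hM : M = m.map (algebraMap R _) := (Localization.AtPrime.map_eq_maximalIdeal).symm
  have hfst : ∀ y ∈ M, (g y).fst = 0 := by
    intro y hy
    rw [hM] at hy
    have hle : m.map (algebraMap R (Localization.AtPrime m)) ≤
        RingHom.ker ((TrivSqZeroExt.fstHom K K W).toRingHom.comp g) := by
      rw [Ideal.map_le_iff_le_comap]
      intro r hr
      change (g (algebraMap R _ r)).fst = 0
      rw [hg]
      exact (hm r).1 hr
    exact hle hy
  let G : Set (Localization.AtPrime m) := M.generators
  have hGfin : G.Finite := Submodule.FG.finite_generators hfg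
  have hGspan : Ideal.span G = M := Submodule.span_generators M
  have hGM : ∀ y ∈ G, y ∈ M := fun y hy => hGspan ▸ Ideal.subset_span hy
  let T : Set W := (fun y => (g y).snd) '' G
  have hTfin : T.Finite := hGfin.image _
  have hle : ∀ y ∈ M, (g y).snd ∈ Submodule.span K T := by
    intro y hy
    rw [← hGspan] at hy
    induction hy using Submodule.span_induction with
    | mem y hy => exact Submodule.subset_span ⟨y, hy, rfl⟩
    | zero => simp
    | add x y _ _ hx hy => rw [map_add, TrivSqZeroExt.snd_add]; exact add_mem hx hy
    -- On `M` the first component of `g` vanishes, so the second is linear through the residue map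
    -- of `g`. Thus the images of ideal generators span over `K`.
    | smul a x hx' hx =>
      rw [smul_eq_mul, map_mul, TrivSqZeroExt.snd_mul, hfst x (hGspan ▸ hx')]
      simpa using Submodule.smul_mem _ _ hx
  have htop : Submodule.span K T = ⊤ := by
    rw [eq_top_iff, ← hW, Submodule.span_le]
    rintro w ⟨r, hr, hw⟩
    have := hle (algebraMap R _ r) (hM ▸ Ideal.mem_map_of_mem _ hr)
    rwa [hg, hw, TrivSqZeroExt.snd_inr] at this
  calc Module.finrank K W = Module.finrank K (⊤ : Submodule K W) := finrank_top K W |>.symm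
    _ = Module.finrank K (Submodule.span K T) := by rw [htop]
    _ ≤ T.ncard := by
      have := hTfin.fintype
      rw [Set.ncard_eq_toFinset_card']
      exact finrank_span_le_card T
    _ ≤ G.ncard := Set.ncard_image_le hGfin
    _ = M.spanFinrank := Submodule.FG.generators_ncard hfg

end Tangent

/-! ### The tangent space at the distinguished point -/

section Core

variable (K : Type u) [Field K] {P G : Type u} [AddCommMonoid P] [AddCommGroup G]
  [Module.Free ℤ G] [Module.Finite ℤ G] (ι : P →+ G)

/-- At most `rank G` pairwise nonassociated irreducibles and independent units. -/
lemma card_le_of_isRegularLocalRing (hι : Function.Injective ι)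
    (hreg : ∀ (m : Ideal (AddMonoidAlgebra K P)) [m.IsPrime],
      ringKrullDim (Localization.AtPrime m) ≤ Module.finrank ℤ G →
        IsRegularLocalRing (Localization.AtPrime m))
    (U : Submodule ℤ G) (hU : ∀ p : P, ι p ∈ U ↔ IsAddUnit p) {I J : Type*} [Fintype I] [Fintype J]
    (a : I → P) (ha : ∀ i, AddIrreducible (a i))
    (hane : ∀ i j, ι (a i) - ι (a j) ∈ U → i = j)
    (hUP : ∀ g ∈ U, ∃ p, ι p = g)
    (g : Module.Basis J ℤ U) :
    Fintype.card I + Fintype.card J ≤ Module.finrank ℤ G := by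
  classical
  have hadd : ∀ p q : P, IsAddUnit (p + q) ↔ IsAddUnit p ∧ IsAddUnit q := fun p q =>
    IsAddUnit.add_iff
  -- `x` is the character of the distinguished point. `D` is an `x`-derivation: on units it reads
  -- off the coordinates `φ` in the basis `g`, elsewhere the indicators `ψ` of the classes of the `a
  -- i`.
  let x : P → K := fun p => if IsAddUnit p then 1 else 0
  let φ : G → J → K := fun h j => if hh : h ∈ U then ((g.repr ⟨h, hh⟩ j : ℤ) : K) else 0
  let ψ : P → I → K := fun p i => if ι p - ι (a i) ∈ U then 1 else 0
  let D : P → I ⊕ J → K := fun p => if IsAddUnit p then Sum.elim 0 (φ (ι p)) else Sum.elim (ψ p) 0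
  have hφ : ∀ h (hh : h ∈ U) j, φ h j = ((g.repr ⟨h, hh⟩ j : ℤ) : K) := fun h hh j => dif_pos hh
  have hφadd : ∀ h ∈ U, ∀ h' ∈ U, φ (h + h') = φ h + φ h' := by
    intro h hh h' hh'
    have e : (⟨h + h', add_mem hh hh'⟩ : U) = ⟨h, hh⟩ + ⟨h', hh'⟩ := rfl
    ext j
    rw [Pi.add_apply, hφ _ (add_mem hh hh'), hφ _ hh, hφ _ hh', e, map_add, Finsupp.add_apply,
      Int.cast_add]
  have hφ0 : φ 0 = 0 := by simpa using hφadd 0 U.zero_mem 0 U.zero_mem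
  have hx0 : x 0 = 1 := if_pos isAddUnit_zero
  have hD0 : D 0 = 0 := by
    ext i
    simp only [D, if_pos isAddUnit_zero]
    rcases i with i | j
    · rfl
    · simp [hφ0]
  have hx : ∀ p q, x (p + q) = x p * x q := by
    intro p q
    simp only [x, hadd]
    by_cases hp : IsAddUnit p <;> by_cases hq : IsAddUnit q <;> simp [hp, hq]
  have hψ : ∀ p q, IsAddUnit p → ψ (p + q) = ψ q := by
    intro p q hp
    ext i
    simp only [ψ, map_add, add_sub_assoc]
    rw [Submodule.add_mem_iff_right U ((hU p).2 hp)]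
  have hD : ∀ p q, D (p + q) = x p • D q + x q • D p := by
    intro p q
    by_cases hp : IsAddUnit p <;> by_cases hq : IsAddUnit q
    · have hpU := (hU p).2 hp
      have hqU := (hU q).2 hq
      ext i
      rcases i with i | j
      · simp [D, x, hadd, hp, hq]
      · simp [D, x, hadd, hp, hq, hφadd _ hpU _ hqU, add_comm]
    · simp [D, x, hadd, hp, hq, hψ p q hp]
    · simp [D, x, hadd, hp, hq, add_comm p q, hψ q p hq]
    -- If a sum of two nonunits differed from `a i` by a unit, that unit could be absorbed into a
    -- summand, contradicting irreducibility.
    · have : ψ (p + q) = 0 := by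
        ext i
        simp only [ψ, Pi.zero_apply, ite_eq_right_iff, one_ne_zero, imp_false]
        intro hmem
        obtain ⟨u, hu⟩ := hUP _ hmem
        have huU : IsAddUnit u := (hU u).1 (hu ▸ hmem)
        obtain ⟨v, huv⟩ := huU.exists_neg
        have hi : a i = p + (q + v) := by
          apply hι
          have h1 : ι u + ι v = 0 := by rw [← map_add, huv, map_zero]
          rw [map_add, map_add]
          rw [map_add] at hu
          have h2 : ι v = -ι u := (neg_eq_of_add_eq_zero_right h1).symm
          rw [h2, hu]
          abel
        rcases (ha i).isAddUnit_or_isAddUnit hi with h | h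
        · exact hp h
        · exact hq ((hadd _ _).1 h).1
      simp [D, x, hadd, hp, hq, this]
  let χ : Multiplicative P →* TrivSqZeroExt K (I ⊕ J → K) :=
    { toFun := fun p => TrivSqZeroExt.inl (x p.toAdd) + TrivSqZeroExt.inr (D p.toAdd)
      map_one' := by
        rw [toAdd_one, hx0, hD0]
        simp
      map_mul' := by
        intro p q
        rw [toAdd_mul, hx, hD]
        ext
        · simp
        · simp }
  let f : AddMonoidAlgebra K P →ₐ[K] TrivSqZeroExt K (I ⊕ J → K) := AddMonoidAlgebra.lift K _ _ χ
  have hf : ∀ p, f (AddMonoidAlgebra.single p 1) =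
      TrivSqZeroExt.inl (x p) + TrivSqZeroExt.inr (D p) := by
    intro p
    simp [f, χ, AddMonoidAlgebra.lift_single]
  let m : Ideal (AddMonoidAlgebra K P) :=
    RingHom.ker ((TrivSqZeroExt.fstHom K K (I ⊕ J → K)).comp f)
  have : m.IsPrime := RingHom.ker_isPrime _
  -- This bound makes `hreg` applicable; regularity then turns it into a bound on the number of
  -- generators of the maximal ideal.
  have hdim : ringKrullDim (Localization.AtPrime m) ≤ Module.finrank ℤ G := by
    rw [IsLocalization.AtPrime.ringKrullDim_eq_height m]
    exact Ideal.height_le_ringKrullDim_of_isPrime.trans (ringKrullDim_addMonoidAlgebra_le K ι hι)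
  have hR := hreg m hdim
  have h1 := hR.spanFinrank_maximalIdeal
  rw [← h1] at hdim
  have h2 := finrank_le_spanFinrank_of_trivSqZeroExt f m (fun r => Iff.rfl)
    (IsNoetherian.noetherian _) ?_
  · rw [Module.finrank_pi, Fintype.card_sum] at h2
    exact h2.trans (by exact_mod_cast hdim)
  -- The basis vectors are hit by `e_{a i}` and by `e_p - 1` with `ι p = g j`.
  · rw [eq_top_iff, ← (Pi.basisFun K (I ⊕ J)).span_eq, Submodule.span_le]
    rintro _ ⟨i | j, rfl⟩
    · refine Submodule.subset_span ⟨AddMonoidAlgebra.single (a i) 1, ?_, ?_⟩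
      · change (f _).fst = 0
        rw [hf]
        simp [x, (ha i).not_isAddUnit]
      · rw [hf]
        ext k
        · simp [x, (ha i).not_isAddUnit]
        · rcases k with k | k
          · simp only [D, x, (ha i).not_isAddUnit, ψ]
            by_cases hik : i = k
            · simp [hik]
            · simp [mt (hane i k) hik, Ne.symm hik]
          · simp [D, x, (ha i).not_isAddUnit]
    · obtain ⟨p, hp⟩ := hUP _ (g j).2
      have hpU : ι p ∈ U := hp ▸ (g j).2
      have hpu : IsAddUnit p := (hU p).1 hpU
      refine Submodule.subset_span ⟨AddMonoidAlgebra.single p 1 - 1, ?_, ?_⟩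
      · change (f _).fst = 0
        rw [map_sub, hf]
        simp [x, hpu]
      · rw [map_sub, hf]
        ext k
        · simp [x, hpu]
        · rcases k with k | k
          · simp [D, hpu]
          · simp [D, hpu, φ, hp, Pi.single_apply, Finsupp.single_apply, eq_comm]

end Core

/-! ### From regularity to a basis of the ambient group -/

section Core

/-- A graded monoid is generated by its irreducible elements up to units. -/
lemma exists_sum_irreducible_add_unit {P G : Type*} [AddCommMonoid P] [AddCommGroup G]
    (ι : P →+ G) (U : Submodule ℤ G) (hU : ∀ p : P, ι p ∈ U ↔ IsAddUnit p) (ℓ : G →+ ℤ)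
    (hℓ : ∀ p, 0 ≤ ℓ (ι p)) (hℓ0 : ∀ p, ℓ (ι p) = 0 → IsAddUnit p)
    {I : Type*} [Fintype I] (a : I → P) (ha : ∀ p, AddIrreducible p → ∃ i, ι p - ι (a i) ∈ U)
    (p : P) : ∃ k : I → ℕ, ∃ u ∈ U, ι p = ∑ i, k i • ι (a i) + u := by
  classical
  suffices H : ∀ n : ℕ, ∀ p, ℓ (ι p) = n →
      ∃ k : I → ℕ, ∃ u ∈ U, ι p = ∑ i, k i • ι (a i) + u from
    H (ℓ (ι p)).toNat p (Int.toNat_of_nonneg (hℓ p)).symm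
  intro n
  induction n using Nat.strong_induction_on with
  | _ n ih =>
    intro p hp
    by_cases hu : IsAddUnit p
    · exact ⟨0, ι p, (hU p).2 hu, by simp⟩
    by_cases hirr : AddIrreducible p
    · obtain ⟨i, hi⟩ := ha p hirr
      exact ⟨Pi.single i 1, _, hi, by simp [Pi.single_apply]⟩
    · obtain ⟨x, y, hxy, hx, hy⟩ : ∃ x y, p = x + y ∧ ¬ IsAddUnit x ∧ ¬ IsAddUnit y := by
        by_contra! hcon
        refine hirr ⟨hu, fun x y hxy => ?_⟩
        by_cases hx : IsAddUnit x
        · exact Or.inl hx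
        · exact Or.inr (hcon x y hxy hx)
      -- Nonunits have positive degree, so both summands have smaller degree than `p`.
      have hx0 : ℓ (ι x) ≠ 0 := mt (hℓ0 x) hx
      have hy0 : ℓ (ι y) ≠ 0 := mt (hℓ0 y) hy
      have hx1 := hℓ x
      have hy1 := hℓ y
      have hadd : ℓ (ι p) = ℓ (ι x) + ℓ (ι y) := by rw [hxy, map_add, map_add]
      obtain ⟨k, u, hu, hk⟩ := ih (ℓ (ι x)).toNat (by omega) x (by omega)
      obtain ⟨l, v, hv, hl⟩ := ih (ℓ (ι y)).toNat (by omega) y (by omega)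
      refine ⟨k + l, u + v, add_mem hu hv, ?_⟩
      simp only [hxy, map_add, hk, hl, Pi.add_apply, add_smul, Finset.sum_add_distrib]
      abel

variable (K : Type u) [Field K] {P G : Type u} [AddCommMonoid P] [AddCommGroup G]
  [Module.Free ℤ G] [Module.Finite ℤ G] (ι : P →+ G)

/-- If the monoid algebra of `P` is regular in dimension at most the rank of the ambient group `G`,
then `P` is cut out in `G` by the nonnegativity of some coordinates of a basis. -/
theorem exists_basis_of_isRegularLocalRing (hι : Function.Injective ι)
    (hreg : ∀ (m : Ideal (AddMonoidAlgebra K P)) [m.IsPrime],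
      ringKrullDim (Localization.AtPrime m) ≤ Module.finrank ℤ G →
        IsRegularLocalRing (Localization.AtPrime m))
    (hgen : Submodule.span ℤ (Set.range ι) = ⊤) (ℓ : G →+ ℤ)
    (hℓ : ∀ p, 0 ≤ ℓ (ι p)) (hℓ0 : ∀ p, ℓ (ι p) = 0 → IsAddUnit p) :
    ∃ (b : Module.Basis (Fin (Module.finrank ℤ G)) ℤ G) (s : Set (Fin (Module.finrank ℤ G))),
      ∀ g, g ∈ Set.range ι ↔ ∀ i ∈ s, 0 ≤ b.repr g i := by
  classical
  let U : Submodule ℤ G := AddSubgroup.toIntSubmodule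
    { carrier := {g | ∃ p, IsAddUnit p ∧ ι p = g}
      zero_mem' := ⟨0, isAddUnit_zero, map_zero ι⟩
      add_mem' := by
        rintro _ _ ⟨p, hp, rfl⟩ ⟨q, hq, rfl⟩
        exact ⟨p + q, hp.add hq, map_add ι p q⟩
      neg_mem' := by
        rintro _ ⟨p, hp, rfl⟩
        obtain ⟨q, hq⟩ := hp.exists_neg
        refine ⟨q, .of_add_eq_zero p (by rw [add_comm, hq]), ?_⟩
        rw [eq_neg_iff_add_eq_zero, ← map_add, add_comm q, hq, map_zero] }
  have hU : ∀ p : P, ι p ∈ U ↔ IsAddUnit p := by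
    intro p
    constructor
    · rintro ⟨q, hq, hqp⟩
      rwa [← hι hqp]
    · exact fun hp => ⟨p, hp, rfl⟩
  have hUP : ∀ g ∈ U, ∃ p, ι p = g := fun g ⟨p, _, hp⟩ => ⟨p, hp⟩
  let g := Module.finBasis ℤ U
  let π : {p : P // AddIrreducible p} → G ⧸ U := fun p => U.mkQ (ι p)
  let a : Set.range π → P := fun q => (q.2.choose : P)
  have ha : ∀ q, AddIrreducible (a q) := fun q => q.2.choose.2
  have haq : ∀ q, U.mkQ (ι (a q)) = q := fun q => q.2.choose_spec
  have hane : ∀ i j, ι (a i) - ι (a j) ∈ U → i = j := by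
    intro i j h
    apply Subtype.ext
    rw [← haq, ← haq]
    exact (Submodule.Quotient.eq U).2 h
  -- Infinitely many classes would include `n + 1`, against the tangent bound; no finite generation
  -- of `P` is needed.
  have hfin : Finite (Set.range π) := by
    by_contra hinf
    rw [not_finite_iff_infinite] at hinf
    obtain ⟨t, ht⟩ := Infinite.exists_subset_card_eq (Set.range π) (Module.finrank ℤ G + 1)
    have := card_le_of_isRegularLocalRing K ι hι hreg U hU (fun i : t => a i) (fun i => ha i)
      (fun i j h => Subtype.ext (hane _ _ h)) hUP g
    rw [Fintype.card_coe] at this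
    omega
  have := Fintype.ofFinite (Set.range π)
  have hcard := card_le_of_isRegularLocalRing K ι hι hreg U hU a ha hane hUP g
  have hsum := exists_sum_irreducible_add_unit ι U hU ℓ hℓ hℓ0 a fun p hp => by
    let q : Set.range π := ⟨π ⟨p, hp⟩, ⟨p, hp⟩, rfl⟩
    exact ⟨q, (Submodule.Quotient.eq U).1 (haq q).symm⟩
  let c : Set.range π ⊕ Fin (Module.finrank ℤ U) → G :=
    Sum.elim (fun i => ι (a i)) fun j => (g j : G)
  have hUspan : ∀ u ∈ U, u ∈ Submodule.span ℤ (Set.range fun j => (g j : G)) := by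
    intro u hu
    have h1 : (⟨u, hu⟩ : U) ∈ Submodule.span ℤ (Set.range g) := by
      rw [g.span_eq]
      exact Submodule.mem_top
    have h2 := Submodule.mem_map_of_mem (f := U.subtype) h1
    rwa [Submodule.map_span, ← Set.range_comp] at h2
  have hc : ∀ i, c i ∈ Submodule.span ℤ (Set.range c) := fun i => Submodule.subset_span ⟨i, rfl⟩
  have hspan : ⊤ ≤ Submodule.span ℤ (Set.range c) := by
    rw [← hgen, Submodule.span_le]
    rintro _ ⟨p, rfl⟩
    obtain ⟨k, u, hu, hk⟩ := hsum p
    rw [hk]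
    refine add_mem (sum_mem fun i _ => nsmul_mem (hc (Sum.inl i)) _) ?_
    refine Submodule.span_mono ?_ (hUspan u hu)
    rintro _ ⟨j, rfl⟩
    exact ⟨Sum.inr j, rfl⟩
  -- The tangent bound gives `≤`, and spanning gives `≥`.
  have hcard' : Fintype.card (Set.range π ⊕ Fin (Module.finrank ℤ U)) = Module.finrank ℤ G := by
    apply le_antisymm
    · rwa [Fintype.card_sum]
    · have := finrank_range_le_card (R := ℤ) c
      rwa [Set.finrank, eq_top_iff.2 hspan, finrank_top] at this
  let B := basisOfTopLeSpanOfCardEqFinrank c hspan hcard'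
  have hB : ∀ i, B i = c i := fun i => by simp [B]
  let e := Fintype.equivFinOfCardEq hcard'
  have hBU : ∀ u ∈ U, ∀ i, B.coord (Sum.inl i) u = 0 := by
    intro u hu i
    have hle : Submodule.span ℤ (Set.range fun j => (g j : G)) ≤
        LinearMap.ker (B.coord (Sum.inl i)) := by
      rw [Submodule.span_le]
      rintro _ ⟨j, rfl⟩
      have : (g j : G) = B (Sum.inr j) := (hB (Sum.inr j)).symm
      simp [this]
    exact hle (hUspan u hu)
  refine ⟨B.reindex e, Set.range fun i => e (Sum.inl i), fun x => ⟨?_, ?_⟩⟩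
  · rintro ⟨p, rfl⟩ _ ⟨i, rfl⟩
    obtain ⟨k, u, hu, hk⟩ := hsum p
    have : ∀ j, ι (a j) = B (Sum.inl j) := fun j => (hB (Sum.inl j)).symm
    rw [Module.Basis.repr_reindex_apply, Equiv.symm_apply_apply, ← Module.Basis.coord_apply, hk,
      map_add, hBU u hu, map_sum]
    simp [this, Finsupp.single_apply]
  · intro h
    rw [← B.sum_repr x, Fintype.sum_sum_type]
    have h1 : ∀ i, 0 ≤ B.repr x (Sum.inl i) := by
      intro i
      have := h _ ⟨i, rfl⟩
      rwa [Module.Basis.repr_reindex_apply, Equiv.symm_apply_apply] at this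
    have h2 : ∑ j, B.repr x (Sum.inr j) • B (Sum.inr j) ∈ U := by
      refine sum_mem fun j _ => U.smul_mem _ ?_
      rw [hB]
      exact (g j).2
    obtain ⟨p, hp⟩ := hUP _ h2
    refine ⟨∑ i, (B.repr x (Sum.inl i)).toNat • a i + p, ?_⟩
    rw [map_add, hp, map_sum]
    congr 1
    refine Finset.sum_congr rfl fun i _ => ?_
    rw [map_nsmul, ← natCast_zsmul, Int.toNat_of_nonneg (h1 i), hB]
    rfl

end Core

/-! ### Lattices, dual bases and integral separation -/

section Lattices

variable {V : Type u} [AddCommGroup V] [Module ℝ V] {N : AddSubgroup V}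

lemma IsZStructure.ext_dual (hN : IsZStructure N) {u v : Module.Dual ℝ V}
    (h : ∀ x ∈ N, u x = v x) : u = v :=
  LinearMap.ext_on hN.span_eq_top h

/-- Restriction of an integral linear form to the lattice. -/
def dualLatticeRestrict (N : AddSubgroup V) : dualLattice N →ₗ[ℤ] Module.Dual ℤ N :=
  AddMonoidHom.toIntLinearMap
    { toFun := fun u => AddMonoidHom.toIntLinearMap
        { toFun := fun x => (u.2 x x.2).choose
          map_zero' := by
            have := (u.2 (0 : N) (0 : N).2).choose_spec
            rw [← Int.cast_inj (α := ℝ), ← this]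
            simp
          map_add' := fun x y => by
            rw [← Int.cast_inj (α := ℝ), Int.cast_add, ← (u.2 (x + y : N) (x + y).2).choose_spec,
              ← (u.2 x x.2).choose_spec, ← (u.2 y y.2).choose_spec]
            simp }
      map_zero' := by
        ext x
        have := ((0 : dualLattice N).2 x x.2).choose_spec
        change ((0 : dualLattice N).2 x x.2).choose = 0
        rw [← Int.cast_inj (α := ℝ), ← this]
        simp
      map_add' := fun u v => by
        ext x
        change ((u + v).2 x x.2).choose = (u.2 x x.2).choose + (v.2 x x.2).choose
        rw [← Int.cast_inj (α := ℝ), Int.cast_add, ← ((u + v).2 x x.2).choose_spec,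
          ← (u.2 x x.2).choose_spec, ← (v.2 x x.2).choose_spec]
        rfl }

lemma dualLatticeRestrict_apply (u : dualLattice N) (x : N) :
    (dualLatticeRestrict N u x : ℝ) = u.1 x :=
  (u.2 x x.2).choose_spec.symm

/-- A `ℤ`-basis of a `ℤ`-structure is an `ℝ`-basis of the ambient space. -/
lemma IsZStructure.exists_realBasis (hN : IsZStructure N)
    (c : Module.Basis (Fin (Module.finrank ℝ V)) ℤ N) :
    ∃ B : Module.Basis (Fin (Module.finrank ℝ V)) ℝ V, (∀ i, B i = c i) ∧
      ∀ (x : N) i, B.repr x i = c.repr x i := by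
  have hsum : ∀ x : N, (x : V) = ∑ i, (c.repr x i : ℝ) • (c i : V) := by
    intro x
    have h := congrArg N.subtype (c.sum_repr x).symm
    rw [map_sum] at h
    refine h.trans (Finset.sum_congr rfl fun i _ => ?_)
    rw [map_zsmul, Int.cast_smul_eq_zsmul]
    rfl
  have hspan : ⊤ ≤ Submodule.span ℝ (Set.range fun i => (c i : V)) := by
    rw [← hN.span_eq_top, Submodule.span_le]
    intro x hx
    have h : ∑ i, (c.repr ⟨x, hx⟩ i : ℝ) • (c i : V) ∈
        Submodule.span ℝ (Set.range fun i => (c i : V)) :=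
      sum_mem fun i _ => Submodule.smul_mem _ _ (Submodule.subset_span ⟨i, rfl⟩)
    rwa [← hsum ⟨x, hx⟩] at h
  let B := basisOfTopLeSpanOfCardEqFinrank _ hspan (Fintype.card_fin _)
  have hB : ∀ i, B i = c i := fun i => by simp [B]
  refine ⟨B, hB, fun x i => ?_⟩
  conv_lhs => rw [hsum x]
  simp [← hB, Finsupp.single_apply]

variable [FiniteDimensional ℝ V]

lemma IsZStructure.exists_basis (hN : IsZStructure N) :
    Nonempty (Module.Basis (Fin (Module.finrank ℝ V)) ℤ N) := by
  have := hN.free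
  have hfin : Module.Finite ℤ N := by
    -- Rank `0` does not itself imply finite generation, since it is also the default value of
    -- `finrank`.
    rcases Nat.eq_zero_or_pos (Module.finrank ℝ V) with h | h
    · have : Subsingleton V := Module.finrank_zero_iff.1 h
      infer_instance
    · exact Module.finite_of_finrank_pos (hN.finrank_eq ▸ h)
  exact ⟨(Module.finBasis ℤ N).reindex (finCongr hN.finrank_eq)⟩

lemma IsZStructure.dualLatticeRestrict_bijective (hN : IsZStructure N) :
    Function.Bijective (dualLatticeRestrict N) := by
  constructor
  · intro u v huv
    refine Subtype.ext (hN.ext_dual fun x hx => ?_)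
    rw [← dualLatticeRestrict_apply u ⟨x, hx⟩, huv, dualLatticeRestrict_apply]
  · intro f
    obtain ⟨c⟩ := hN.exists_basis
    obtain ⟨B, hB, hBr⟩ := hN.exists_realBasis c
    let w : Module.Dual ℝ V := B.constr ℝ fun i => (f (c i) : ℝ)
    have hw : ∀ x : N, w x = f x := by
      intro x
      rw [Module.Basis.constr_apply_fintype, ← c.sum_repr x, map_sum, Int.cast_sum]
      refine Finset.sum_congr rfl fun i _ => ?_
      rw [c.sum_repr x, Module.Basis.equivFun_apply, hBr]
      simp
    refine ⟨⟨w, fun x hx => ⟨f ⟨x, hx⟩, hw ⟨x, hx⟩⟩⟩, ?_⟩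
    ext x
    rw [← Int.cast_inj (α := ℝ), dualLatticeRestrict_apply]
    exact hw x

/-- The dual lattice is the `ℤ`-dual of the lattice. -/
def IsZStructure.dualLatticeEquiv (hN : IsZStructure N) : dualLattice N ≃ₗ[ℤ] Module.Dual ℤ N :=
  LinearEquiv.ofBijective _ hN.dualLatticeRestrict_bijective

lemma IsZStructure.dualLatticeEquiv_apply (hN : IsZStructure N) (u : dualLattice N) (x : N) :
    (hN.dualLatticeEquiv u x : ℝ) = u.1 x :=
  dualLatticeRestrict_apply u x

lemma IsZStructure.exists_basis_dualLattice (hN : IsZStructure N) :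
    Nonempty (Module.Basis (Fin (Module.finrank ℝ V)) ℤ (dualLattice N)) := by
  obtain ⟨c⟩ := hN.exists_basis
  exact ⟨c.dualBasis.map hN.dualLatticeEquiv.symm⟩

/-- Every basis of the dual lattice is dual to a basis of the lattice. -/
lemma IsZStructure.exists_dualBasis (hN : IsZStructure N)
    (b : Module.Basis (Fin (Module.finrank ℝ V)) ℤ (dualLattice N)) :
    ∃ c : Module.Basis (Fin (Module.finrank ℝ V)) ℤ N,
      ∀ i j, (b i).1 (c j) = if i = j then 1 else 0 := by
  obtain ⟨c₀⟩ := hN.exists_basis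
  have := Module.Free.of_basis c₀
  have := Module.Finite.of_basis c₀
  let b' := b.map hN.dualLatticeEquiv
  -- The dual of `b'` lives in the double dual, which is identified with `N`.
  refine ⟨b'.dualBasis.map (Module.evalEquiv ℤ N).symm, fun i j => ?_⟩
  rw [← hN.dualLatticeEquiv_apply]
  have h1 : hN.dualLatticeEquiv (b i) = b' i := by simp [b']
  have h2 : ∀ y, b' i ((Module.evalEquiv ℤ N).symm y) = y (b' i) := by
    intro y
    obtain ⟨x, rfl⟩ := (Module.evalEquiv ℤ N).surjective y
    rw [LinearEquiv.symm_apply_apply]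
    rfl
  have h3 : (b'.dualBasis.map (Module.evalEquiv ℤ N).symm) j =
      (Module.evalEquiv ℤ N).symm (b'.dualBasis j) := Module.Basis.map_apply _ _ _
  rw [h1, h3, h2, Module.Basis.dualBasis_apply_self]
  split_ifs <;> simp_all

/-- Integral Gordan alternative: a finite set whose convex hull misses the origin is strictly
positive for some integral linear form. -/
lemma IsZStructure.exists_forall_pos (hN : IsZStructure N) (A : Finset V)
    (hA : (0 : V) ∉ convexHull ℝ (A : Set V)) :
    ∃ u ∈ dualLattice N, ∀ a ∈ A, 0 < u a := by
  obtain ⟨c⟩ := hN.exists_basis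
  obtain ⟨B, hB, hBr⟩ := hN.exists_realBasis c
  let e := B.equivFun
  let C := convexHull ℝ (e '' (A : Set V))
  have hC : (0 : Fin (Module.finrank ℝ V) → ℝ) ∉ C := by
    intro h
    have : e '' convexHull ℝ (A : Set V) = C := e.toLinearMap.image_convexHull _
    rw [← this] at h
    obtain ⟨x, hx, hx0⟩ := h
    rw [LinearEquiv.map_eq_zero_iff] at hx0
    exact hA (hx0 ▸ hx)
  obtain ⟨f, r, hf0, hf⟩ := geometric_hahn_banach_point_closed (convex_convexHull ℝ _)
    ((A.finite_toSet.image e).isCompact_convexHull ℝ).isClosed hC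
  rw [map_zero] at hf0
  have hfA : ∀ a ∈ A, r < f (e a) := fun a ha => hf _ (subset_convexHull ℝ _ ⟨a, ha, rfl⟩)
  let t : Fin (Module.finrank ℝ V) → ℝ := fun i => f (Pi.single i 1)
  have hft : ∀ x, f (e x) = ∑ i, t i * e x i := by
    intro x
    conv_lhs => rw [pi_eq_sum_univ' (e x), map_sum]
    refine Finset.sum_congr rfl fun i _ => ?_
    rw [map_smul, smul_eq_mul, mul_comm]
  -- Rounding the coefficients of `k f` down to integers changes its value at `a` by at most `∑ i,
  -- |e a i|`. This `k` makes `k r` exceed all these errors.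
  obtain ⟨k, hk⟩ := exists_nat_gt ((∑ a ∈ A, ∑ i, |e a i|) / r)
  rw [div_lt_iff₀ hf0] at hk
  let u : Module.Dual ℝ V := ∑ i, (⌊k * t i⌋ : ℝ) • B.coord i
  have hu : ∀ x, u x = ∑ i, (⌊k * t i⌋ : ℝ) * e x i := by
    intro x
    simp [u, e]
  refine ⟨u, fun x hx => ⟨∑ i, ⌊k * t i⌋ * c.repr ⟨x, hx⟩ i, ?_⟩, fun a ha => ?_⟩
  · rw [hu, Int.cast_sum]
    refine Finset.sum_congr rfl fun i _ => ?_
    rw [Int.cast_mul, ← hBr]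
    rfl
  · have h1 : ∑ i, |e a i| ≤ ∑ a ∈ A, ∑ i, |e a i| :=
      Finset.single_le_sum (f := fun a => ∑ i, |e a i|)
        (fun a _ => Finset.sum_nonneg fun i _ => abs_nonneg _) ha
    have h2 : k * f (e a) - u a ≤ ∑ i, |e a i| := by
      rw [hu, hft, Finset.mul_sum, ← Finset.sum_sub_distrib]
      refine Finset.sum_le_sum fun i _ => ?_
      have h3 := Int.floor_le (k * t i)
      have h4 := Int.lt_floor_add_one (k * t i)
      rw [← mul_assoc, ← sub_mul]
      refine (le_abs_self _).trans ?_
      rw [abs_mul]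
      refine mul_le_of_le_one_left (abs_nonneg _) ?_
      rw [abs_le]
      constructor <;> linarith
    have h5 : k * r ≤ k * f (e a) := by
      gcongr
      exact (hfA a ha).le
    linarith

end Lattices

/-! ### Polycones and their dual monoids -/

section Polycones

variable {V : Type u} [AddCommGroup V] [Module ℝ V] {N : AddSubgroup V}

lemma smul_mem_cone {σ : PointedCone ℝ V} {x : V} (hx : x ∈ σ) {r : ℝ} (hr : 0 ≤ r) : r • x ∈ σ :=
  PointedCone.smul_mem σ hr hx

lemma nonneg_of_mem_hull {s : Set V} {u : Module.Dual ℝ V} (h : ∀ a ∈ s, 0 ≤ u a) {x : V}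
    (hx : x ∈ PointedCone.hull ℝ s) : 0 ≤ u x := by
  induction hx using Submodule.span_induction with
  | mem a ha => exact h a ha
  | zero => simp
  | add x y _ _ hx hy => rw [map_add]; exact add_nonneg hx hy
  | smul c x _ hx =>
    change 0 ≤ u ((c : ℝ) • x)
    rw [map_smul]
    exact mul_nonneg c.2 hx

lemma convexHull_subset_hull (s : Set V) : convexHull ℝ s ⊆ PointedCone.hull ℝ s := by
  refine convexHull_min PointedCone.subset_hull ?_
  intro x hx y hy a b ha hb _
  exact add_mem (smul_mem_cone hx ha) (smul_mem_cone hy hb)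

/-- A convex combination equal to `0` would put a nonzero multiple of some `a` and its negative in
`σ`. -/
lemma zero_notMem_convexHull {σ : PointedCone ℝ V} (hσ : ∀ x ∈ σ, -x ∈ σ → x = 0) (A : Finset V)
    (hA : ∀ a ∈ A, a ∈ σ) (hA0 : (0 : V) ∉ A) : (0 : V) ∉ convexHull ℝ (A : Set V) := by
  classical
  rw [Finset.mem_convexHull']
  rintro ⟨w, hw, hw1, hw0⟩
  obtain ⟨a, ha, hwa⟩ : ∃ a ∈ A, w a ≠ 0 := by
    by_contra! hcon
    rw [Finset.sum_eq_zero hcon] at hw1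
    exact zero_ne_one hw1
  rw [← Finset.add_sum_erase A _ ha] at hw0
  have h1 : w a • a ∈ σ := smul_mem_cone (hA a ha) (hw a ha)
  have h2 : -(w a • a) ∈ σ := by
    rw [← eq_neg_of_add_eq_zero_right hw0]
    exact sum_mem fun y hy =>
      smul_mem_cone (hA y (Finset.mem_of_mem_erase hy)) (hw y (Finset.mem_of_mem_erase hy))
  rcases smul_eq_zero.1 (hσ _ h1 h2) with h | h
  · exact hwa h
  · exact hA0 (h ▸ ha)

lemma IsPolycone.exists_generators_ne_zero {σ : PointedCone ℝ V} (hσ : IsPolycone N σ) :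
    ∃ A : Finset V, (A : Set V) ⊆ N ∧ (0 : V) ∉ A ∧ σ = PointedCone.hull ℝ (A : Set V) := by
  classical
  obtain ⟨A, hAN, rfl⟩ := hσ.exists_generators
  refine ⟨A.erase 0, fun a ha => hAN (Finset.mem_of_mem_erase ha), Finset.notMem_erase 0 A, ?_⟩
  rw [Finset.coe_erase]
  exact (Submodule.span_sdiff_singleton_zero).symm

/-- If `0` lay on a segment from `-x` to the hull of `A`, then `x` would be a nonnegative multiple
of a point of `σ`. This lets a form be positive on `A` and negative at `x`. -/
lemma zero_notMem_convexHull_insert_neg {σ : PointedCone ℝ V} {A : Finset V}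
    (hσ : σ = PointedCone.hull ℝ (A : Set V)) (hA : (0 : V) ∉ convexHull ℝ (A : Set V)) {x : V}
    (hx : x ∉ σ) : (0 : V) ∉ convexHull ℝ (insert (-x) (A : Set V)) := by
  rcases (A : Set V).eq_empty_or_nonempty with h | h
  · rw [h, insert_empty_eq, convexHull_singleton, Set.mem_singleton_iff]
    intro h0
    rw [zero_eq_neg] at h0
    exact hx (h0 ▸ σ.zero_mem)
  · rw [convexHull_insert h, mem_convexJoin]
    rintro ⟨y, hy, z, hz, a, b, ha, hb, hab, h0⟩
    rw [Set.mem_singleton_iff] at hy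
    subst hy
    have hzσ : z ∈ σ := hσ ▸ convexHull_subset_hull _ hz
    rcases ha.eq_or_lt with h1 | h1
    · rw [← h1, zero_add] at hab
      rw [← h1, hab, zero_smul, zero_add, one_smul] at h0
      exact hA (h0 ▸ hz)
    · apply hx
      have : x = a⁻¹ • b • z := by
        rw [smul_neg, neg_add_eq_zero] at h0
        rw [← h0, smul_smul, inv_mul_cancel₀ h1.ne', one_smul]
      rw [this]
      exact smul_mem_cone (smul_mem_cone hzσ hb) (inv_nonneg.2 ha)

variable [FiniteDimensional ℝ V]

/-- A polycone is determined by its dual monoid. -/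
lemma IsPolycone.mem_of_forall_dualMonoid (hN : IsZStructure N) {σ : PointedCone ℝ V}
    (hσ : IsPolycone N σ) {x : V} (hx : ∀ u ∈ dualMonoid N σ, 0 ≤ u x) : x ∈ σ := by
  classical
  by_contra hxσ
  obtain ⟨A, hAN, hA0, hA⟩ := hσ.exists_generators_ne_zero
  have h0 := zero_notMem_convexHull hσ.salient A (fun a ha => hA ▸ PointedCone.subset_hull ha) hA0
  have h1 := zero_notMem_convexHull_insert_neg hA h0 hxσ
  rw [← Finset.coe_insert] at h1
  obtain ⟨u, hu, hpos⟩ := hN.exists_forall_pos _ h1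
  have h2 := hx u ⟨hu, fun y hy =>
    nonneg_of_mem_hull (fun a ha => (hpos a (Finset.mem_insert_of_mem ha)).le) (hA ▸ hy)⟩
  have h3 := hpos (-x) (Finset.mem_insert_self _ _)
  rw [map_neg] at h3
  linarith

/-- The dual monoid of a polycone generates the dual lattice. -/
lemma IsPolycone.span_dualMonoid (hN : IsZStructure N) {σ : PointedCone ℝ V}
    (hσ : IsPolycone N σ) :
    Submodule.span ℤ {u : dualLattice N | u.1 ∈ dualMonoid N σ} = ⊤ := by
  obtain ⟨A, hAN, hA0, hA⟩ := hσ.exists_generators_ne_zero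
  have h0 := zero_notMem_convexHull hσ.salient A (fun a ha => hA ▸ PointedCone.subset_hull ha) hA0
  obtain ⟨u, hu, hpos⟩ := hN.exists_forall_pos _ h0
  have huσ : u ∈ dualMonoid N σ :=
    ⟨hu, fun y hy => nonneg_of_mem_hull (fun a ha => (hpos a ha).le) (hA ▸ hy)⟩
  -- As `u` cuts out the zero face, `m + k • u` lies in the dual monoid for large `k`, and `m` is a
  -- difference of two elements of it.
  have hbot : ∀ x, x ∈ (⊥ : PointedCone ℝ V) ↔ x ∈ σ ∧ u x = 0 := by
    intro x
    constructor
    · intro hx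
      rw [Submodule.mem_bot] at hx
      simp [hx]
    · rintro ⟨hx, hx0⟩
      rw [hA] at hx
      obtain ⟨c, hcA, hc, rfl⟩ := PointedCone.mem_hull_set.1 hx
      rw [Finsupp.sum, map_sum, Finset.sum_eq_zero_iff_of_nonneg] at hx0
      · rw [Submodule.mem_bot, Finsupp.sum]
        refine Finset.sum_eq_zero fun a ha => ?_
        have := hx0 a ha
        rw [map_smul, smul_eq_mul, mul_eq_zero] at this
        rcases this with h | h
        · rw [h, zero_smul]
        · exact absurd h (hpos a (hcA ha)).ne'
      · intro a ha
        rw [map_smul]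
        exact mul_nonneg (hc a) (hpos a (hcA ha)).le
  rw [eq_top_iff]
  intro m _
  obtain ⟨k, hk⟩ := exists_nsmul_add_mem hσ huσ hbot (m := m.1)
    ⟨m.2, fun x hx => by rw [(Submodule.mem_bot _).1 hx, map_zero]⟩
  have h1 : m + k • (⟨u, hu⟩ : dualLattice N) ∈
      Submodule.span ℤ {u : dualLattice N | u.1 ∈ dualMonoid N σ} :=
    Submodule.subset_span (hk k le_rfl)
  have h2 : (⟨u, hu⟩ : dualLattice N) ∈
      Submodule.span ℤ {u : dualLattice N | u.1 ∈ dualMonoid N σ} :=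
    Submodule.subset_span huσ
  simpa using sub_mem h1 (nsmul_mem h2 k)

/-- If `K[σ^∨ ∩ M]` is regular in dimension at most `dim V`, then `σ` is generated by part of a
basis of `N`. -/
theorem IsPolycone.exists_basis_of_isRegularLocalRing (hN : IsZStructure N) {σ : PointedCone ℝ V}
    (hσ : IsPolycone N σ) (K : Type u) [Field K]
    (hreg : ∀ (m : Ideal (AddMonoidAlgebra K (dualMonoid N σ))) [m.IsPrime],
      ringKrullDim (Localization.AtPrime m) ≤ Module.finrank ℝ V →
        IsRegularLocalRing (Localization.AtPrime m)) :
    ∃ (b : Module.Basis (Fin (Module.finrank ℝ V)) ℤ N) (s : Set (Fin (Module.finrank ℝ V))),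
      σ = PointedCone.hull ℝ ((fun i => (b i : V)) '' s) := by
  classical
  obtain ⟨b₀⟩ := hN.exists_basis_dualLattice
  have := Module.Free.of_basis b₀
  have := Module.Finite.of_basis b₀
  have hrank : Module.finrank ℤ (dualLattice N) = Module.finrank ℝ V := by
    rw [Module.finrank_eq_card_basis b₀, Fintype.card_fin]
  obtain ⟨A, hAN, hA⟩ := hσ.exists_generators
  let ι : dualMonoid N σ →+ dualLattice N :=
    { toFun := fun u => ⟨u.1, u.2.1⟩
      map_zero' := rfl
      map_add' := fun _ _ => rfl }
  have hι : Function.Injective ι := fun u v h => 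
    Subtype.ext (congrArg (fun w : dualLattice N => w.1) h)
  have hrange : Set.range ι = {u : dualLattice N | u.1 ∈ dualMonoid N σ} := by
    ext u
    exact ⟨by rintro ⟨v, rfl⟩; exact v.2, fun hu => ⟨⟨u.1, hu⟩, rfl⟩⟩
  -- Evaluation at the sum of the generators is the grading: a form of degree `0` vanishes on every
  -- generator, so its negative is also in the dual monoid.
  let x : N := ⟨∑ a ∈ A, a, sum_mem fun a ha => hAN ha⟩
  let ℓ : dualLattice N →+ ℤ :=
    { toFun := fun u => dualLatticeRestrict N u x
      map_zero' := by simp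
      map_add' := fun u v => by simp }
  have hAσ : ∀ a ∈ A, a ∈ σ := fun a ha => hA ▸ PointedCone.subset_hull ha
  have hℓ : ∀ u, (ℓ u : ℝ) = ∑ a ∈ A, u.1 a := by
    intro u
    refine (dualLatticeRestrict_apply u x).trans ?_
    rw [map_sum]
  obtain ⟨b, s, hb⟩ := ToricScheme.exists_basis_of_isRegularLocalRing K ι hι (by rwa [hrank])
    (by rw [hrange]; exact hσ.span_dualMonoid hN) ℓ
    (fun u => by
      rw [← Int.cast_nonneg_iff (R := ℝ), hℓ]
      exact Finset.sum_nonneg fun a ha => u.2.2 a (hAσ a ha))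
    (fun u hu => by
      rw [← Int.cast_eq_zero (α := ℝ), hℓ,
        Finset.sum_eq_zero_iff_of_nonneg (f := fun a => (ι u).1 a)
          fun a ha => u.2.2 a (hAσ a ha)] at hu
      have hneg : -u.1 ∈ dualMonoid N σ := by
        refine ⟨neg_mem u.2.1, fun y hy => nonneg_of_mem_hull (fun a ha => ?_) (hA ▸ hy)⟩
        have h0 : u.1 a = 0 := hu a ha
        rw [LinearMap.neg_apply, h0, neg_zero]
      exact .of_add_eq_zero ⟨-u.1, hneg⟩ (Subtype.ext (add_neg_cancel u.1)))
  rw [hrange] at hb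
  let b' := b.reindex (finCongr hrank)
  obtain ⟨c, hc⟩ := hN.exists_dualBasis b'
  obtain ⟨B, hB, hBr⟩ := hN.exists_realBasis c
  let s' := {i | (finCongr hrank).symm i ∈ s}
  have hb' : ∀ u : dualLattice N, u.1 ∈ dualMonoid N σ ↔ ∀ i ∈ s', 0 ≤ b'.repr u i := by
    intro u
    refine (hb u).trans ⟨fun h i hi => ?_, fun h i hi => ?_⟩
    · rw [Module.Basis.repr_reindex_apply]
      exact h _ hi
    · have := h (finCongr hrank i) (by simpa [s'] using hi)
      rwa [Module.Basis.repr_reindex_apply, Equiv.symm_apply_apply] at this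
  have hcoord : ∀ i y, (b' i).1 y = B.repr y i := by
    intro i y
    conv_lhs => rw [← B.sum_repr y]
    simp [hB, hc]
  refine ⟨c, s', le_antisymm ?_ ?_⟩
  · intro y hy
    have hpos : ∀ i ∈ s', 0 ≤ B.repr y i := by
      intro i hi
      rw [← hcoord]
      refine ((hb' (b' i)).2 fun j _ => ?_).2 y hy
      rw [Module.Basis.repr_self, Finsupp.single_apply]
      split_ifs <;> simp
    have hzero : ∀ i ∉ s', B.repr y i = 0 := by
      intro i hi
      rw [← hcoord]
      have h1 : 0 ≤ (b' i).1 y := by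
        refine ((hb' (b' i)).2 fun j hj => ?_).2 y hy
        rw [Module.Basis.repr_self, Finsupp.single_apply]
        split_ifs <;> simp
      -- For `i ∉ s'` the sign of the coordinate is unconstrained, so both `b' i` and `-b' i` are
      -- nonnegative on `σ`.
      have h2 : 0 ≤ (-b' i : dualLattice N).1 y := by
        refine ((hb' (-b' i)).2 fun j hj => ?_).2 y hy
        rw [map_neg, Module.Basis.repr_self, Finsupp.neg_apply,
          Finsupp.single_eq_of_ne (by rintro rfl; exact hi hj), neg_zero]
      have h3 : (-b' i : dualLattice N).1 y = -(b' i).1 y := rfl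
      linarith
    rw [← B.sum_repr y]
    refine sum_mem fun i _ => ?_
    by_cases hi : i ∈ s'
    · have hmem : B i ∈ PointedCone.hull ℝ ((fun i => (c i : V)) '' s') :=
        PointedCone.subset_hull ⟨i, hi, (hB i).symm⟩
      exact smul_mem_cone hmem (hpos i hi)
    · rw [hzero i hi, zero_smul]
      exact zero_mem _
  · refine Submodule.span_le.2 ?_
    rintro _ ⟨i, hi, rfl⟩
    refine hσ.mem_of_forall_dualMonoid hN fun u hu => ?_
    have h1 := (hb' ⟨u, hu.1⟩).1 hu i hi
    have h2 : u (c i) = b'.repr ⟨u, hu.1⟩ i := by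
      have h3 : u = ∑ j, (b'.repr ⟨u, hu.1⟩ j) • (b' j).1 := by
        have h := congrArg (dualLattice N).subtype (b'.sum_repr ⟨u, hu.1⟩).symm
        rw [map_sum] at h
        exact h
      conv_lhs => rw [h3]
      simp [hc]
    change 0 ≤ u (c i)
    rw [h2]
    exact_mod_cast h1

end Polycones

/-! ### Locality of `(R_k)` -/

section SerreProperty

lemma HasR.of_isOpenImmersion {k : ℕ} {X Y : Scheme.{u}} (f : X ⟶ Y) [IsOpenImmersion f]
    (h : HasR k Y) : HasR k X := by
  have := h.1
  refine ⟨isLocallyNoetherian_of_isOpenImmersion f, fun x hx => ?_⟩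
  let e : Y.presheaf.stalk (f x) ≃+* X.presheaf.stalk x :=
    (asIso (f.stalkMap x)).commRingCatIsoToRingEquiv
  have := h.2 (f x) (by rwa [ringKrullDim_eq_of_ringEquiv e])
  exact IsRegularLocalRing.of_ringEquiv e

lemma HasR.of_openCover {k : ℕ} {X : Scheme.{u}} (𝒰 : X.OpenCover) (h : ∀ i, HasR k (𝒰.X i)) :
    HasR k X := by
  refine ⟨(isLocallyNoetherian_iff_openCover 𝒰).2 fun i => (h i).1, fun x hx => ?_⟩
  obtain ⟨i, y, rfl⟩ : ∃ i, ∃ y, 𝒰.f i y = x := ⟨_, 𝒰.covers x⟩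
  let e : X.presheaf.stalk (𝒰.f i y) ≃+* (𝒰.X i).presheaf.stalk y :=
    (asIso ((𝒰.f i).stalkMap y)).commRingCatIsoToRingEquiv
  have := (h i).2 y (by rwa [← ringKrullDim_eq_of_ringEquiv e])
  exact IsRegularLocalRing.of_ringEquiv e.symm

lemma hasR_Spec_iff {k : ℕ} {R : Type u} [CommRing R] :
    HasR k (Spec (CommRingCat.of R)) ↔ IsNoetherianRing R ∧ ∀ (p : Ideal R) [p.IsPrime],
      ringKrullDim (Localization.AtPrime p) ≤ k → IsRegularLocalRing (Localization.AtPrime p) := by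
  let e : ∀ x : PrimeSpectrum R,
      Localization.AtPrime x.asIdeal ≃+* (Spec (CommRingCat.of R)).presheaf.stalk x := fun x =>
    (IsLocalization.algEquiv x.asIdeal.primeCompl (Localization.AtPrime x.asIdeal)
      ((Spec.structureSheaf R).presheaf.stalk x)).toRingEquiv
  refine and_congr isLocallyNoetherian_Spec ⟨fun h p hp hk => ?_, fun h x hk => ?_⟩
  · have := h ⟨p, hp⟩ (by rwa [← ringKrullDim_eq_of_ringEquiv (e ⟨p, hp⟩)])
    exact IsRegularLocalRing.of_ringEquiv (e ⟨p, hp⟩).symm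
  · have := x.2
    have := h x.asIdeal (by rwa [ringKrullDim_eq_of_ringEquiv (e x)])
    exact IsRegularLocalRing.of_ringEquiv (e x)

end SerreProperty

/-! ### Fibres and products with `Spec K` -/

section Products

/-- `X × Y`. -/
abbrev absProd (X Y : Scheme.{u}) : Scheme.{u} := pullback (terminal.from X) (terminal.from Y)

/-- The base change of a fibre of `X × S → S` is the product of `X` with the spectrum of the
extension field. -/
def fiberProdIso (X S : Scheme.{u}) (z : S) (K : Type u) [Field K] [Algebra (S.residueField z) K] :
    pullback ((pullback.snd (terminal.from X) (terminal.from S)).fiberToSpecResidueField z)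
      (Spec.map (CommRingCat.ofHom (algebraMap (S.residueField z) K))) ≅
    absProd X (Spec (CommRingCat.of K)) :=
  pullbackLeftPullbackSndIso _ _ _ ≪≫ pullbackLeftPullbackSndIso _ _ _ ≪≫
    pullback.congrHom rfl (Subsingleton.elim _ _)

/-- The map from the initial ring. -/
def intHom (A : Type u) [CommRing A] : CommRingCat.of (ULift.{u} ℤ) ⟶ CommRingCat.of A :=
  CommRingCat.ofHom ((Int.castRingHom A).comp ULift.ringEquiv.toRingHom)

lemma intHom_hom_ext {A : CommRingCat.{u}} (f g : CommRingCat.of (ULift.{u} ℤ) ⟶ A) : f = g :=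
  CommRingCat.isInitial.hom_ext f g

/-- `K[P]` is the coproduct of `ℤ[P]` and `K`. -/
lemma isPushout_monoidAlgebra (K P : Type u) [CommRing K] [AddCommMonoid P] :
    IsPushout (intHom (AddMonoidAlgebra ℤ P)) (intHom K)
      (CommRingCat.ofHom (AddMonoidAlgebra.mapRingHom P (Int.castRingHom K)))
      (CommRingCat.ofHom (AddMonoidAlgebra.singleZeroRingHom (R := K) (M := P))) := by
  -- A ring map out of `K[P]` is a ring map on `K` together with a monoid map on `P`; the latter is
  -- read off from `ℤ[P]`.
  refine ⟨⟨intHom_hom_ext _ _⟩, ⟨PushoutCocone.IsColimit.mk _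
    (fun s => CommRingCat.ofHom (AddMonoidAlgebra.liftNCRingHom s.inr.hom
      ((s.inl.hom : AddMonoidAlgebra ℤ P →* s.pt).comp (AddMonoidAlgebra.of ℤ P))
      fun _ _ => Commute.all _ _)) ?_ ?_ ?_⟩⟩
  · intro s
    ext1
    apply AddMonoidAlgebra.ringHom_ext
    · intro r
      have h1 : s.inl.hom (AddMonoidAlgebra.single 0 1) = 1 := map_one s.inl.hom
      have h2 : s.inl.hom (AddMonoidAlgebra.single 0 r) = r :=
        eq_intCast (s.inl.hom.comp AddMonoidAlgebra.singleZeroRingHom) r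
      simp [h1, h2]
    · intro p
      simp [AddMonoidAlgebra.liftNCRingHom]
  · intro s
    ext x
    have h1 : s.inl.hom (AddMonoidAlgebra.single 0 1) = 1 := map_one s.inl.hom
    simp [AddMonoidAlgebra.liftNCRingHom, h1]
  · intro s m h1 h2
    have h3 : s.inl.hom (AddMonoidAlgebra.single 0 1) = 1 := map_one s.inl.hom
    ext1
    apply AddMonoidAlgebra.ringHom_ext
    · intro r
      have := congrArg (fun f => f.hom r) h2
      simpa [AddMonoidAlgebra.liftNCRingHom, h3] using this
    · intro p
      have := congrArg (fun f => f.hom (AddMonoidAlgebra.single p 1)) h1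
      simpa [AddMonoidAlgebra.liftNCRingHom] using this

/-- The spectrum of `ℤ` is the terminal scheme. -/
def terminalIsoSpec : (⊤_ Scheme.{u}) ≅ Spec (CommRingCat.of (ULift.{u} ℤ)) :=
  terminalIsTerminal.uniqueUpToIso specULiftZIsTerminal

/-- `Spec ℤ[P] × Spec K = Spec K[P]`. -/
def specMonoidAlgebraProdIso (K P : Type u) [CommRing K] [AddCommMonoid P] :
    absProd (Spec (CommRingCat.of (AddMonoidAlgebra ℤ P))) (Spec (CommRingCat.of K)) ≅
      Spec (CommRingCat.of (AddMonoidAlgebra K P)) :=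
  asIso (pullback.map _ _ (Spec.map (intHom (AddMonoidAlgebra ℤ P))) (Spec.map (intHom K))
    (𝟙 _) (𝟙 _) terminalIsoSpec.hom
    (specULiftZIsTerminal.hom_ext _ _) (specULiftZIsTerminal.hom_ext _ _)) ≪≫
    (isPullback_SpecMap_of_isPushout _ _ _ _ (isPushout_monoidAlgebra K P)).isoPullback.symm

/-- The product of a morphism with a scheme. -/
def prodMap {X Y : Scheme.{u}} (f : X ⟶ Y) (Z : Scheme.{u}) : absProd X Z ⟶ absProd Y Z :=
  pullback.map (terminal.from X) (terminal.from Z) (terminal.from Y) (terminal.from Z) f (𝟙 Z) (𝟙 _)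
    (Subsingleton.elim _ _) (Subsingleton.elim _ _)

instance isOpenImmersion_prodMap {X Y : Scheme.{u}} (f : X ⟶ Y) [IsOpenImmersion f]
    (Z : Scheme.{u}) : IsOpenImmersion (prodMap f Z) := by
  unfold prodMap
  infer_instance

end Products

/-! ### Flatness over `ℤ` -/

section Flatness

lemma flat_terminal_from_spec (P : Type u) [AddCommMonoid P] :
    Flat (terminal.from (Spec (CommRingCat.of (AddMonoidAlgebra ℤ P)))) := by
  have : terminal.from (Spec (CommRingCat.of (AddMonoidAlgebra ℤ P))) =
      Spec.map (intHom (AddMonoidAlgebra ℤ P)) ≫ terminalIsoSpec.inv := Subsingleton.elim _ _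
  rw [this]
  have : Flat (Spec.map (intHom (AddMonoidAlgebra ℤ P))) := by
    rw [Flat.SpecMap_iff]
    refine RingHom.Flat.comp (.of_bijective ULift.ringEquiv.bijective) ?_
    rw [← algebraMap_int_eq, RingHom.flat_algebraMap_iff]
    infer_instance
  infer_instance

end Flatness

/-! ### Regular fans and the two main implications -/

section RegularFans

variable {V : Type u} [AddCommGroup V] [Module ℝ V] {N : AddSubgroup V}

/-- The open cover of `X_Σ(ℤ) × Z` by the products of the affine pieces. -/
def NFan.prodCover (F : NFan N) (Z : Scheme.{u}) : (absProd F.toricSchemeInt Z).OpenCover :=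
  Scheme.Pullback.openCoverOfLeft (Scheme.IsLocallyDirected.openCover F.diagram) _ _

/-- The pieces of `NFan.prodCover`. -/
def NFan.prodCoverIso (F : NFan N) (Z : Scheme.{u}) (σ : F.Index) :
    (F.prodCover Z).X σ ≅
      absProd (Spec (CommRingCat.of (AddMonoidAlgebra ℤ (dualMonoid N σ.1)))) Z :=
  pullback.congrHom (Subsingleton.elim _ _) rfl

lemma NFan.hasR_prod_iff (F : NFan N) (k : ℕ) (K : Type u) [Field K] :
    HasR k (absProd F.toricSchemeInt (Spec (CommRingCat.of K))) ↔
      ∀ σ ∈ F.cones, HasR k (Spec (CommRingCat.of (AddMonoidAlgebra K (dualMonoid N σ)))) := by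
  let e : ∀ σ : F.Index, (F.prodCover (Spec (CommRingCat.of K))).X σ ≅
      Spec (CommRingCat.of (AddMonoidAlgebra K (dualMonoid N σ.1))) := fun σ =>
    F.prodCoverIso _ σ ≪≫ specMonoidAlgebraProdIso K _
  constructor
  · intro h σ hσ
    have := (F.prodCover (Spec (CommRingCat.of K))).map_prop ⟨σ, hσ⟩
    have h1 := h.of_isOpenImmersion ((F.prodCover (Spec (CommRingCat.of K))).f ⟨σ, hσ⟩)
    exact h1.of_isOpenImmersion (e ⟨σ, hσ⟩).inv
  · intro h
    refine HasR.of_openCover (F.prodCover _) fun σ => ?_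
    exact (h σ.1 σ.2).of_isOpenImmersion (e σ).hom

/-- Flatness is local on the source and stable under base change, so the affine pieces over `ℤ`
suffice. -/
lemma NFan.flat_toricMorphism (F : NFan N) (S : Scheme.{u}) : Flat (F.toricMorphism S) := by
  have hflat : Flat (terminal.from F.toricSchemeInt) := by
    have := HasRingHomProperty.instIsZariskiLocalAtSource (P := @Flat) (Q := RingHom.Flat)
    refine (IsZariskiLocalAtSource.iff_of_openCover (P := @Flat)
      (Scheme.IsLocallyDirected.openCover F.diagram)).2 fun σ => ?_
    have h := flat_terminal_from_spec (dualMonoid N (σ : F.Index).1)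
    have e : (Scheme.IsLocallyDirected.openCover F.diagram).f σ ≫ terminal.from F.toricSchemeInt =
      terminal.from (F.diagram.obj σ) := Subsingleton.elim _ _
    exact e ▸ h
  have := Flat.isStableUnderBaseChange
  exact MorphismProperty.of_isPullback (P := @Flat) (IsPullback.of_hasPullback _ _) hflat

lemma mem_hull_image_basis_iff {n : ℕ} (B : Module.Basis (Fin n) ℝ V) (s : Set (Fin n)) (x : V) :
    x ∈ PointedCone.hull ℝ (B '' s) ↔ (∀ i, 0 ≤ B.repr x i) ∧ ∀ i ∉ s, B.repr x i = 0 := by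
  constructor
  · intro hx
    refine ⟨fun i => nonneg_of_mem_hull (u := B.coord i) ?_ hx, fun i hi => le_antisymm ?_ ?_⟩
    · rintro _ ⟨j, -, rfl⟩
      rw [B.coord_apply, B.repr_self, Finsupp.single_apply]
      split_ifs <;> simp
    · have := nonneg_of_mem_hull (u := -B.coord i) ?_ hx
      · simpa using this
      · rintro _ ⟨j, hj, rfl⟩
        rw [LinearMap.neg_apply, B.coord_apply, B.repr_self,
          Finsupp.single_eq_of_ne (by rintro rfl; exact hi hj), neg_zero]
    · refine nonneg_of_mem_hull (u := B.coord i) ?_ hx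
      rintro _ ⟨j, -, rfl⟩
      rw [B.coord_apply, B.repr_self, Finsupp.single_apply]
      split_ifs <;> simp
  · rintro ⟨h1, h2⟩
    rw [← B.sum_repr x]
    refine sum_mem fun i _ => ?_
    by_cases hi : i ∈ s
    · exact smul_mem_cone (σ := PointedCone.hull ℝ (B '' s))
        (PointedCone.subset_hull ⟨i, hi, rfl⟩) (h1 i)
    · rw [h2 i hi, zero_smul]
      exact zero_mem _

/-- The dual monoid of the cone generated by a basis of `N` is free. -/
lemma exists_dualMonoid_equiv (b : Module.Basis (Fin (Module.finrank ℝ V)) ℤ N)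
    (B : Module.Basis (Fin (Module.finrank ℝ V)) ℝ V) (hB : ∀ i, B i = b i)
    (hBr : ∀ (x : N) i, B.repr x i = b.repr x i) :
    Nonempty (dualMonoid N (PointedCone.hull ℝ (B '' Set.univ)) ≃+
      (Fin (Module.finrank ℝ V) →₀ ℕ)) := by
  let f : (Fin (Module.finrank ℝ V) →₀ ℕ) →+ Module.Dual ℝ V :=
    { toFun := fun k => ∑ i, (k i : ℝ) • B.coord i
      map_zero' := by simp
      map_add' := fun k l => by simp [add_smul, Finset.sum_add_distrib] }
  have hfB : ∀ k j, f k (B j) = k j := by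
    intro k j
    simp [f, Finsupp.single_apply]
  have hf : ∀ k, f k ∈ dualMonoid N (PointedCone.hull ℝ (B '' Set.univ)) := by
    intro k
    refine ⟨fun x hx => ⟨∑ i, k i * b.repr ⟨x, hx⟩ i, ?_⟩, fun x hx => ?_⟩
    · simp [f, ← hBr]
    · refine nonneg_of_mem_hull ?_ hx
      rintro _ ⟨j, -, rfl⟩
      rw [hfB]
      positivity
  let g := f.codRestrict _ hf
  refine ⟨(AddEquiv.ofBijective g ⟨fun k l hkl => ?_, fun u => ?_⟩).symm⟩
  · ext j
    have h1 : f k = f l := congrArg (fun w : dualMonoid N _ => w.1) hkl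
    have h2 := hfB k j
    rw [h1, hfB] at h2
    exact_mod_cast h2.symm
  · have h0 : ∀ i, ∃ k : ℕ, u.1 (B i) = k := by
      intro i
      obtain ⟨m, hm⟩ := u.2.1 (B i) (hB i ▸ (b i).2)
      have h1 := u.2.2 (B i) (PointedCone.subset_hull ⟨i, trivial, rfl⟩)
      rw [hm] at h1
      lift m to ℕ using by exact_mod_cast h1
      exact ⟨m, by exact_mod_cast hm⟩
    choose k hk using h0
    refine ⟨Finsupp.equivFunOnFinite.symm k, Subtype.ext (B.ext fun i => ?_)⟩
    rw [hk]
    exact hfB _ i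

/-- The affine toric variety of a cone generated by part of a basis of `N` is regular. -/
lemma hasR_of_isRegular (hN : IsZStructure N) (σ : PointedCone ℝ V)
    (b : Module.Basis (Fin (Module.finrank ℝ V)) ℤ N) (s : Set (Fin (Module.finrank ℝ V)))
    (hσ : σ = PointedCone.hull ℝ ((fun i => (b i : V)) '' s)) (k : ℕ) (K : Type u) [Field K] :
    HasR k (Spec (CommRingCat.of (AddMonoidAlgebra K (dualMonoid N σ)))) := by
  classical
  obtain ⟨B, hB, hBr⟩ := hN.exists_realBasis b
  let τ := PointedCone.hull ℝ (B '' Set.univ)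
  simp only [← hB] at hσ
  have hστ : σ ≤ τ := hσ ▸ Submodule.span_mono (Set.image_mono (Set.subset_univ s))
  have hτmem : ∀ x, x ∈ τ ↔ ∀ i, 0 ≤ B.repr x i := fun x => by
    simpa [τ] using mem_hull_image_basis_iff B Set.univ x
  have hτ : IsPolycone N τ := by
    refine ⟨⟨Finset.univ.image B, ?_, by simp [τ]⟩, fun x hx hx' => ?_⟩
    · intro x hx
      obtain ⟨i, -, rfl⟩ := Finset.mem_image.1 hx
      exact hB i ▸ (b i).2
    · refine B.repr.map_eq_zero_iff.1 (Finsupp.ext fun i => le_antisymm ?_ ((hτmem x).1 hx i))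
      simpa using (hτmem (-x)).1 hx' i
  -- On `τ` all coordinates are nonnegative, so this sum vanishes exactly where each coordinate
  -- outside `s` does, that is, on `σ`.
  let u : Module.Dual ℝ V := ∑ i with i ∉ s, B.coord i
  have hux : ∀ x, u x = ∑ i with i ∉ s, B.repr x i := fun x => by simp [u]
  have hu : u ∈ dualMonoid N τ := by
    refine ⟨fun x hx => ⟨∑ i with i ∉ s, b.repr ⟨x, hx⟩ i, ?_⟩, fun x hx => ?_⟩
    · rw [hux, Int.cast_sum]
      exact Finset.sum_congr rfl fun i _ => hBr ⟨x, hx⟩ i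
    · rw [hux]
      exact Finset.sum_nonneg fun i _ => (hτmem x).1 hx i
  have huσ : ∀ x, x ∈ σ ↔ x ∈ τ ∧ u x = 0 := by
    intro x
    rw [hτmem, hux, hσ]
    refine (mem_hull_image_basis_iff B s x).trans (and_congr_right fun h => ?_)
    rw [Finset.sum_eq_zero_iff_of_nonneg fun i _ => h i]
    simp
  have := isOpenImmersion_restrictionHom hστ hτ ⟨u, hu⟩ huσ
  have := isOpenImmersion_prodMap (Spec.map (CommRingCat.ofHom (restrictionHom N hστ)))
    (Spec (CommRingCat.of K))
  have h1 : HasR k (Spec (CommRingCat.of (AddMonoidAlgebra K (dualMonoid N τ)))) := by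
    obtain ⟨e⟩ := exists_dualMonoid_equiv b B hB hBr
    have : IsRegularRing (AddMonoidAlgebra K (dualMonoid N τ)) :=
      IsRegularRing.of_ringEquiv (R := MvPolynomial (Fin (Module.finrank ℝ V)) K)
        (AddMonoidAlgebra.domCongr K K e.symm).toRingEquiv
    exact hasR_Spec_iff.2 ⟨inferInstance, fun p _ _ => isRegularRing_iff.1 this p⟩
  have h2 := h1.of_isOpenImmersion (specMonoidAlgebraProdIso K (dualMonoid N τ)).hom
  have h3 := h2.of_isOpenImmersion (prodMap (Spec.map (CommRingCat.ofHom (restrictionHom N hστ)))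
    (Spec (CommRingCat.of K)))
  exact h3.of_isOpenImmersion (specMonoidAlgebraProdIso K (dualMonoid N σ)).inv

/-- If `t_Σ(S)` has `(R_n)` and `S` is nonempty, then `Σ` is `N`-regular. -/
lemma NFan.isRegular_of_homHasR [FiniteDimensional ℝ V] (hN : IsZStructure N) (F : NFan N)
    (S : Scheme.{u}) [Nonempty S] (h : HomHasR (Module.finrank ℝ V) (F.toricMorphism S)) : F.IsRegular := by
  intro σ hσ
  obtain ⟨z⟩ := ‹Nonempty S›
  -- A single fibre, with the trivial extension of its residue field, suffices.
  have h1 := (h.2 z (S.residueField z)).of_isOpenImmersion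
    (fiberProdIso F.toricSchemeInt S z (S.residueField z)).inv
  have h2 := hasR_Spec_iff.1 ((F.hasR_prod_iff _ _).1 h1 σ hσ)
  exact (F.isPolycone σ hσ).exists_basis_of_isRegularLocalRing hN (S.residueField z)
    fun m _ => h2.2 m

/-- If `Σ` is `N`-regular or `S` is empty, then `t_Σ(S)` is regular. -/
lemma NFan.homIsRegular_of_isRegular (hN : IsZStructure N) (F : NFan N) (S : Scheme.{u})
    (h : F.IsRegular ∨ IsEmpty S) : HomIsRegular (F.toricMorphism S) := by
  intro k
  refine ⟨F.flat_toricMorphism S, fun z K _ _ _ => ?_⟩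
  have hF := h.resolve_right fun hS => hS.elim z
  let e := fiberProdIso F.toricSchemeInt S z K
  have he : IsOpenImmersion e.hom := inferInstance
  refine @HasR.of_isOpenImmersion _ _ _ e.hom he ((F.hasR_prod_iff _ _).2 fun σ hσ => ?_)
  obtain ⟨b, s, hs⟩ := hF σ hσ
  exact hasR_of_isRegular hN σ b s hs k K

end RegularFans

end ToricScheme

end

theorem mainTheorem2 {V : Type u} [AddCommGroup V] [Module ℝ V] [FiniteDimensional ℝ V]
    {N : AddSubgroup V} (hN : ToricScheme.IsZStructure N) (F : ToricScheme.NFan N)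
    (S : Scheme.{u}) :
    List.TFAE
      [ToricScheme.HomIsRegular (F.toricMorphism S),
        ToricScheme.HomHasR (Module.finrank ℝ V) (F.toricMorphism S),
        F.IsRegular ∨ IsEmpty S] := by
  tfae_have 1 → 2 := fun h => h _
  tfae_have 2 → 3 := by
    refine fun h => or_iff_not_imp_right.2 fun hS => ?_
    have := not_isEmpty_iff.1 hS
    exact F.isRegular_of_homHasR hN S h
  tfae_have 3 → 1 := F.homIsRegular_of_isRegular hN S
  tfae_finish
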